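/- Let $d\ge 2$. Call a nonempty compact convex set $K\subset\mathbb R^d$ *strictly convex with smooth boundary* if it is either a single point, or its boundary is a $C^\infty$ hypersurface all of whose principal curvatures with respect to the outward normal are positive. Let $K_1,K_2\subset\mathbb R^d$ be two such sets, let $\mathbb T^d=\mathbb R^d/2\pi\mathbb Z^d$ and let $\mathfrak p:\mathbb R^d\to\mathbb T^d$ be the projection. Let $\mathcal P_{K_1,K_2}$ be the set of geodesic arcs $\gamma:[0,\ell(\gamma)]\to\mathbb T^d$, $\gamma(\tau)=\gamma(0)+\mathfrak p(\tau\theta)$, of length $\ell(\gamma)>0$ and with unit velocity $\theta$, such that $\gamma(0)=\mathfrak p(x)$ for some $x\in\partial K_1$ at which $\theta$ is an outward normal vector of $K_1$, and $\gamma(\ell(\gamma))=\mathfrak p(y)$ for some $y\in\partial K_2$ at which $\theta$ is an inward normal vector of $K_2$ (if $K_i$ is a point, every unit vector is both an outward and an inward normal vector). For $T_0>0$ set $$\zeta_0(K_1,K_2,s)=\sum_{\gamma\in\mathcal P_{K_1,K_2}:\ \ell(\gamma)>T_0}\ell(\gamma)^{-s}.$$ Let $V_0(K),\dots,V_d(K)$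 denote the intrinsic volumes of a nonempty compact convex set $K\subset\mathbb R^d$, which are defined by Steiner's formula $$\mathrm{Vol}_{\mathbb R^d}(K+tB_d)=\sum_{\ell=0}^d V_{d-\ell}(K)\,\frac{\pi^{\ell/2}}{\Gamma(\frac{\ell}{2}+1)}\,t^\ell\qquad(t>0),$$ where $B_d$ is the closed unit ball, and let $K_1-K_2=\{x-y: x\in K_1,\ y\in K_2\}$. Then Steiner's formula holds for $K_1-K_2$ and, for every $T_0>0$, the set $\{\gamma\in\mathcal P_{K_1,K_2}: T_0<\ell(\gamma)\le T\}$ is finite for every $T$, the series $\zeta_0(K_1,K_2,s)$ converges absolutely for $\operatorname{Re}(s)>d$, and the function $$s\mapsto \zeta_0(K_1,K_2,s)-\frac1{(2\pi)^d}\sum_{\ell=1}^d\frac{\pi^{\ell/2}\,\ell}{\Gamma(\frac{\ell}{2}+1)}\,\frac{V_{d-\ell}(K_1-K_2)}{s-\ell}$$ extends holomorphically from $\{\operatorname{Re}(s)>d\}$ to $\mathbb C$. -/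

import Mathlib

open scoped Pointwise ContDiff

noncomputable section

/-! ## Strictly convex sets with smooth boundary -/

/-- The boundary of `K` is, near its point `x`, a smooth hypersurface bounding `K`, and its second
fundamental form at `x` with respect to the outward normal is positive definite: on a neighbourhood
`U` of `x` the set `K` is `{ρ ≤ 0}` with `ρ` smooth and `dρ(x) ≠ 0`.  Then `ker dρ(x)` is the tangent
space of the boundary at `x`, the outward unit normal is `∇ρ / |∇ρ|`, and the second fundamental form
(the quadratic form of the shape operator) is `D²ρ(x)(v, v) / |∇ρ(x)|`; its sign does not depend on
the choice of `ρ`. -/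
def HasSmoothPositivelyCurvedBoundaryAt {d : ℕ} (K : Set (EuclideanSpace ℝ (Fin d)))
    (x : EuclideanSpace ℝ (Fin d)) : Prop :=
  ∃ (U : Set (EuclideanSpace ℝ (Fin d))) (ρ : EuclideanSpace ℝ (Fin d) → ℝ),
    IsOpen U ∧ x ∈ U ∧ ContDiffOn ℝ ∞ ρ U ∧ K ∩ U = {y ∈ U | ρ y ≤ 0} ∧
    fderiv ℝ ρ x ≠ 0 ∧
    ∀ v : EuclideanSpace ℝ (Fin d), v ≠ 0 → fderiv ℝ ρ x v = 0 →
      0 < fderiv ℝ (fderiv ℝ ρ) x v v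

/-- Compact strictly convex sets with smooth boundary: nonempty compact convex sets that are either
reduced to a point, or whose boundary is a smooth hypersurface all of whose principal curvatures
(with respect to the outward normal) are positive. -/
structure IsSmoothStrictlyConvex {d : ℕ} (K : Set (EuclideanSpace ℝ (Fin d))) : Prop where
  nonempty : K.Nonempty
  isCompact : IsCompact K
  convex : Convex ℝ K
  point_or_curved :
    (∃ a, K = {a}) ∨ ∀ x ∈ frontier K, HasSmoothPositivelyCurvedBoundaryAt K x

/-! ## Unit normal bundles -/

/-- The direct unit normal bundle of a convex set: pairs `(x, θ)` with `x ∈ K` and `θ` a unit outward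
normal vector of `K` at `x`, i.e. `⟪θ, x⟫` is the maximum of `⟪θ, ·⟫` over `K` (so `x` is a
boundary point).  If `K` is a point, every unit vector is allowed. -/
def outwardNormalBundle {d : ℕ} (K : Set (EuclideanSpace ℝ (Fin d))) :
    Set (EuclideanSpace ℝ (Fin d) × EuclideanSpace ℝ (Fin d)) :=
  {p | p.1 ∈ K ∧ ‖p.2‖ = 1 ∧ ∀ y ∈ K, inner ℝ p.2 y ≤ inner ℝ p.2 p.1}

/-- The indirect unit normal bundle: `(x, θ)` with `θ` a unit inward normal vector at `x`. -/
def inwardNormalBundle {d : ℕ} (K : Set (EuclideanSpace ℝ (Fin d))) :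
    Set (EuclideanSpace ℝ (Fin d) × EuclideanSpace ℝ (Fin d)) :=
  {p | (p.1, -p.2) ∈ outwardNormalBundle K}

/-! ## The flat torus and its geodesic arcs -/

/-- The lattice `2πℤ^d` in `ℝ^d`. -/
def torusLattice (d : ℕ) : AddSubgroup (EuclideanSpace ℝ (Fin d)) where
  carrier := {v | ∀ i, ∃ n : ℤ, v i = 2 * Real.pi * n}
  zero_mem' := fun _ => ⟨0, by simp⟩
  add_mem' := by
    intro a b ha hb i
    obtain ⟨m, hm⟩ := ha i
    obtain ⟨n, hn⟩ := hb i
    exact ⟨m + n, by simp [hm, hn]; ring⟩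
  neg_mem' := by
    intro a ha i
    obtain ⟨m, hm⟩ := ha i
    exact ⟨-m, by simp [hm]⟩

/-- The flat torus `ℝ^d / 2πℤ^d`. -/
abbrev FlatTorus (d : ℕ) : Type := EuclideanSpace ℝ (Fin d) ⧸ torusLattice d

/-- The canonical projection `ℝ^d → ℝ^d / 2πℤ^d`. -/
def torusProj {d : ℕ} (x : EuclideanSpace ℝ (Fin d)) : FlatTorus d :=
  QuotientAddGroup.mk x

/-- A geodesic arc of positive length on the flat torus, parametrized by arc length.  It is given by
its length, its starting point and its (constant) unit velocity `θ`; the curve is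
`τ ↦ start + τ θ` for `0 ≤ τ ≤ length`. -/
@[ext]
structure GeodesicArc (d : ℕ) where
  length : ℝ
  start : FlatTorus d
  velocity : EuclideanSpace ℝ (Fin d)
  length_pos : 0 < length
  norm_velocity : ‖velocity‖ = 1

/-- The point of the arc at time `τ`. -/
def GeodesicArc.point {d : ℕ} (γ : GeodesicArc d) (τ : ℝ) : FlatTorus d :=
  γ.start + torusProj (τ • γ.velocity)

/-- The geodesic arcs from the projection of `∂K₁` to the projection of `∂K₂` that are directly
orthogonal to both, the first being oriented by the outward normal of `K₁` and the second by the
inward normal of `K₂`: position and velocity of the arc belong to the projected direct normal bundle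
of `K₁` at the initial time, and to the projected indirect normal bundle of `K₂` at the final
time. -/
def orthogeodesics {d : ℕ} (K₁ K₂ : Set (EuclideanSpace ℝ (Fin d))) : Set (GeodesicArc d) :=
  {γ | (∃ x, (x, γ.velocity) ∈ outwardNormalBundle K₁ ∧ torusProj x = γ.point 0) ∧
    (∃ y, (y, γ.velocity) ∈ inwardNormalBundle K₂ ∧ torusProj y = γ.point γ.length)}

/-- The orthogeodesics of length greater than `T₀`. -/
def longOrthogeodesics {d : ℕ} (K₁ K₂ : Set (EuclideanSpace ℝ (Fin d))) (T₀ : ℝ) :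
    Set (GeodesicArc d) :=
  {γ ∈ orthogeodesics K₁ K₂ | T₀ < γ.length}

/-- The generalized Epstein zeta function `ζ₀(K₁, K₂, s) = ∑ 1 / ℓ(γ)^s`, the sum running over the
orthogeodesics of length greater than `T₀`. -/
def epsteinZeta {d : ℕ} (K₁ K₂ : Set (EuclideanSpace ℝ (Fin d))) (T₀ : ℝ) (s : ℂ) : ℂ :=
  ∑' γ : longOrthogeodesics K₁ K₂ T₀, 1 / (γ.1.length : ℂ) ^ s

/-! ## Intrinsic volumes -/

/-- Steiner's formula for `K`, with coefficients `V 0, …, V d`.  A polynomial being determined by its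
values at `t > 0`, at most one tuple `V 0, …, V d` satisfies it. -/
def SteinerFormula {d : ℕ} (K : Set (EuclideanSpace ℝ (Fin d))) (V : ℕ → ℝ) : Prop :=
  ∀ t : ℝ, 0 < t →
    MeasureTheory.volume.real (K + t • Metric.closedBall (0 : EuclideanSpace ℝ (Fin d)) 1) =
      ∑ l ∈ Finset.range (d + 1),
        V (d - l) * (Real.pi ^ ((l : ℝ) / 2) / Real.Gamma ((l : ℝ) / 2 + 1)) * t ^ l

open Classical in
/-- The `j`-th intrinsic volume of `K` (for `j ≤ d`): the coefficient `V j` in Steiner's formula. -/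
def intrinsicVolume {d : ℕ} (K : Set (EuclideanSpace ℝ (Fin d))) (j : ℕ) : ℝ :=
  if h : ∃ V : ℕ → ℝ, SteinerFormula K V then h.choose j else 0

end

/-! Write `K = K₁ - K₂`. An orthogeodesic with velocity `θ` leaves the unique point `P₁ θ` of `K₁`
with outward normal `θ` and arrives at `P₂ (-θ)`, so, lifted to `ℝ^d`, it is a lattice point `v = ℓθ
+ P θ`, where `P θ = P₁ θ - P₂ (-θ)` is the support point of `K` in direction `θ`. Then `P θ` is the
point of `K` nearest to `v` and `ℓ = dist(v, K)`. Conversely every lattice point outside `K` arises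
exactly once (`exists_equiv_orthogeodesics`). Thus the zeta function is a lattice sum of `dist(v,
K)^(-s)` over `dist(v, K) > T₀`. Replacing the distance by `max(dist, T₀)` gives a continuous
function `f_s` on the whole space and adds only finitely many terms `T₀^(-s)`, which are entire.

The poles come from `∫ f_s` divided by the covolume `(2π)^d`. By Steiner's formula the volume of
`{dist ≤ t}` is a polynomial `∑ a_l t^l`, and the layer-cake formula turns the integral into `∑ a_l
s T₀^(l-s) / (s-l)`, whose polar part is `∑ a_l l / (s-l)` (`integral_distPow`). Steiner's formula
holds because `u ↦ P u + t u` parametrizes the collar around `K` by the punctured ball, with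
Jacobian polynomial in `t`.

The remainder is entire. Let `A` average a function over translates by a fundamental cell. Summed
over the lattice, `A f` gives the normalized integral of `f`, and `(1 - A) f` has integral zero, so
the lattice sum of `f` minus its normalized integral equals the lattice sum of `(1 - A)^(N+1) f` for
every `N` (`tsum_eq_integral_add_tsum_iterate`). Now `(1 - A)^N f` is an average of `N`-fold
differences of `f`. Since `t · dist(v/t, K)` is smooth in `(v, t)` up to `t = 0` away from `v = 0`,
each difference of `f_s` gains a factor `1/|v|`
(`IsSupportMap.exists_norm_iteratedDiff_distPow_le`). The remainder therefore converges for `Re s >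
d - N`, and the continuations for different `N` glue.

Strict convexity and smoothness enter through the smoothness of `P`, obtained from the inverse
function theorem applied to the Lagrange multiplier equations. -/

open scoped Topology
open Filter MeasureTheory

noncomputable section

/-! ## Support maps -/

section SupportMap

variable {E : Type*} [NormedAddCommGroup E] [InnerProductSpace ℝ E]

/-- `P θ` is the unique point of `K` at which `θ` is an outward normal vector, and it depends smoothly
on `θ ≠ 0`. -/
structure IsSupportMap (K : Set E) (P : E → E) : Prop where
  mem : ∀ {θ}, θ ≠ 0 → P θ ∈ K
  inner_le : ∀ {θ}, θ ≠ 0 → ∀ y ∈ K, inner ℝ θ y ≤ inner ℝ θ (P θ)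
  eq : ∀ {θ}, θ ≠ 0 → ∀ x ∈ K, (∀ y ∈ K, inner ℝ θ y ≤ inner ℝ θ x) → x = P θ
  contDiffAt : ∀ {θ}, θ ≠ 0 → ContDiffAt ℝ ∞ P θ

theorem IsSupportMap.smul {K : Set E} {P : E → E} (hP : IsSupportMap K P) {θ : E} (hθ : θ ≠ 0)
    {c : ℝ} (hc : 0 < c) : P (c • θ) = P θ := by
  have h0 : c • θ ≠ 0 := smul_ne_zero hc.ne' hθ
  refine hP.eq hθ _ (hP.mem h0) fun y hy => ?_
  have := hP.inner_le h0 y hy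
  rw [real_inner_smul_left, real_inner_smul_left] at this
  exact le_of_mul_le_mul_left this hc

theorem IsSupportMap.singleton (a : E) : IsSupportMap {a} fun _ => a where
  mem _ := rfl
  inner_le := by rintro θ - y rfl; exact le_rfl
  eq := by rintro θ - x rfl -; rfl
  contDiffAt _ := contDiffAt_const

/-- A linear form is maximal at `a - b` exactly when it is maximal on `K₁` at `a` and minimal on
`K₂` at `b`. Hence smoothness of the support map passes to `K₁ - K₂` without any study of its
boundary. -/
theorem IsSupportMap.sub {K₁ K₂ : Set E} {P₁ P₂ : E → E} (h₁ : IsSupportMap K₁ P₁)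
    (h₂ : IsSupportMap K₂ P₂) : IsSupportMap (K₁ - K₂) fun θ => P₁ θ - P₂ (-θ) where
  mem hθ := Set.sub_mem_sub (h₁.mem hθ) (h₂.mem (neg_ne_zero.2 hθ))
  inner_le := by
    rintro θ hθ _ ⟨a, ha, b, hb, rfl⟩
    have h1 := h₁.inner_le hθ a ha
    have h2 := h₂.inner_le (neg_ne_zero.2 hθ) b hb
    simp only [inner_sub_right, inner_neg_left] at *
    linarith
  eq := by
    rintro θ hθ _ ⟨a, ha, b, hb, rfl⟩ h
    have h1 : a = P₁ θ := h₁.eq hθ a ha fun y hy => by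
      have := h _ (Set.sub_mem_sub hy hb)
      simp only [inner_sub_right] at this
      linarith
    have h2 : b = P₂ (-θ) := h₂.eq (neg_ne_zero.2 hθ) b hb fun y hy => by
      have := h _ (Set.sub_mem_sub ha hy)
      simp only [inner_sub_right, inner_neg_left] at *
      linarith
    simp only [h1, h2]
  contDiffAt hθ := (h₁.contDiffAt hθ).sub
    (ContDiffAt.comp _ (h₂.contDiffAt (neg_ne_zero.2 hθ)) contDiffAt_id.neg)

/-- The set `K` lies in the half-space bounded by the hyperplane through `p` orthogonal to `w`;
Cauchy–Schwarz against `w` bounds the distance below, and `p` attains it. -/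
theorem infDist_eq_norm_of_inner_le {K : Set E} {w p : E} (hp : p ∈ K)
    (h : ∀ y ∈ K, inner ℝ w y ≤ inner ℝ w p) : Metric.infDist (w + p) K = ‖w‖ := by
  apply le_antisymm
  · simpa using Metric.infDist_le_dist_of_mem (x := w + p) hp
  · refine (Metric.le_infDist ⟨p, hp⟩).2 fun {y} hy => ?_
    have h1 := h y hy
    rcases eq_or_ne w 0 with rfl | hw
    · simp
    have h2 : ‖w‖ * ‖w‖ ≤ ‖w‖ * ‖w + p - y‖ := by
      calc ‖w‖ * ‖w‖ = inner ℝ w w := (real_inner_self_eq_norm_mul_norm w).symm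
        _ ≤ inner ℝ w (w + p - y) := by simp only [inner_sub_right, inner_add_right]; linarith
        _ ≤ _ := real_inner_le_norm _ _
    rw [dist_eq_norm]
    exact le_of_mul_le_mul_left h2 (norm_pos_iff.2 hw)

theorem IsSupportMap.infDist {K : Set E} {P : E → E} (hP : IsSupportMap K P) {w : E} (hw : w ≠ 0) :
    Metric.infDist (w + P w) K = ‖w‖ :=
  infDist_eq_norm_of_inner_le (hP.mem hw) (hP.inner_le hw)

/-- The vector from the nearest-point projection of `v` to `v` is an outward normal there. -/
theorem IsSupportMap.exists_add_eq {K : Set E} {P : E → E} (hP : IsSupportMap K P)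
    (hc : IsCompact K) (hn : K.Nonempty) (hcv : Convex ℝ K) {v : E} (hv : v ∉ K) :
    ∃ w, w ≠ 0 ∧ w + P w = v := by
  obtain ⟨p, hp, hmin⟩ := exists_norm_eq_iInf_of_complete_convex hn hc.isComplete hcv v
  rw [norm_eq_iInf_iff_real_inner_le_zero hcv hp] at hmin
  have hw : v - p ≠ 0 := fun h => hv (by rwa [sub_eq_zero.1 h])
  refine ⟨v - p, hw, ?_⟩
  rw [← hP.eq hw p hp fun y hy => ?_]
  · abel
  · have := hmin y hy
    rw [inner_sub_right] at this
    linarith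

/-- Monotonicity of the gradient of the support function: add the two maximality inequalities. It
yields both the injectivity of the normal maps and the positivity of the derivative of `P`. -/
theorem IsSupportMap.inner_sub_nonneg {K : Set E} {P : E → E} (hP : IsSupportMap K P) {u u' : E}
    (hu : u ≠ 0) (hu' : u' ≠ 0) : 0 ≤ inner ℝ (P u - P u') (u - u') := by
  have h1 := hP.inner_le hu _ (hP.mem hu')
  have h2 := hP.inner_le hu' _ (hP.mem hu)
  rw [real_inner_comm]
  simp only [inner_sub_left, inner_sub_right]
  linarith

end SupportMap

/-! ### Uniqueness of the support point on a curved boundary -/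

section Existence

variable {E : Type*} [NormedAddCommGroup E] [InnerProductSpace ℝ E]

/-- `{ρ ≤ 0}` describes `K` on the open set `U`, and `ρ` is smooth there. -/
structure IsLocalDefining (K U : Set E) (ρ : E → ℝ) : Prop where
  isOpen : IsOpen U
  contDiffOn : ContDiffOn ℝ ∞ ρ U
  inter_eq : K ∩ U = {y ∈ U | ρ y ≤ 0}

theorem IsLocalDefining.contDiffAt {K U : Set E} {ρ : E → ℝ} (h : IsLocalDefining K U ρ) {x : E}
    (hx : x ∈ U) : ContDiffAt ℝ ∞ ρ x := h.contDiffOn.contDiffAt (h.isOpen.mem_nhds hx)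

theorem IsLocalDefining.le_zero {K U : Set E} {ρ : E → ℝ} (h : IsLocalDefining K U ρ) {x : E}
    (hx : x ∈ U) (hK : x ∈ K) : ρ x ≤ 0 := by
  have : x ∈ K ∩ U := ⟨hK, hx⟩
  rw [h.inter_eq] at this
  exact this.2

theorem IsLocalDefining.mem {K U : Set E} {ρ : E → ℝ} (h : IsLocalDefining K U ρ) {x : E}
    (hx : x ∈ U) (hρ : ρ x ≤ 0) : x ∈ K := by
  have : x ∈ K ∩ U := by rw [h.inter_eq]; exact ⟨hx, hρ⟩
  exact this.1

theorem tendsto_line (x v : E) : Tendsto (fun t : ℝ => x + t • v) (𝓝[>] 0) (𝓝 x) := by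
  have : Continuous fun t : ℝ => x + t • v := by fun_prop
  have h := this.tendsto 0
  simp only [zero_smul, add_zero] at h
  exact h.mono_left nhdsWithin_le_nhds

theorem IsLocalDefining.eq_zero {K U : Set E} {ρ : E → ℝ} (h : IsLocalDefining K U ρ) {x θ : E}
    (hx : x ∈ U) (hK : x ∈ K) (hθ : θ ≠ 0) (hsup : ∀ y ∈ K, inner ℝ θ y ≤ inner ℝ θ x) :
    ρ x = 0 := by
  refine (h.le_zero hx hK).antisymm (not_lt.1 fun hlt => ?_)
  have h1 : ∀ᶠ y in 𝓝 x, ρ y < 0 ∧ y ∈ U :=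
    ((h.contDiffAt hx).continuousAt.eventually_lt_const hlt).and (h.isOpen.mem_nhds hx)
  obtain ⟨t, ht, ht0⟩ := (((tendsto_line x θ).eventually h1).and self_mem_nhdsWithin).exists
  have h2 := hsup _ (h.mem ht.2 ht.1.le)
  rw [inner_add_right, real_inner_smul_right] at h2
  have h3 : 0 < inner ℝ θ θ := real_inner_self_pos.2 hθ
  have : 0 < t * inner ℝ θ θ := mul_pos ht0 h3
  linarith

/-- A direction in which `ρ` strictly decreases enters `K`, because `ρ x = 0`. -/
theorem IsLocalDefining.inner_nonpos {K U : Set E} {ρ : E → ℝ} (h : IsLocalDefining K U ρ) {x θ : E}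
    (hx : x ∈ U) (hK : x ∈ K) (hθ : θ ≠ 0) (hsup : ∀ y ∈ K, inner ℝ θ y ≤ inner ℝ θ x) {v : E}
    (hv : fderiv ℝ ρ x v < 0) : inner ℝ θ v ≤ 0 := by
  have h0 := h.eq_zero hx hK hθ hsup
  have hd : HasDerivAt (fun t : ℝ => ρ (x + t • v)) (fderiv ℝ ρ x v) 0 := by
    have h1 : HasFDerivAt ρ (fderiv ℝ ρ x) (x + (0 : ℝ) • v) := by
      simpa using ((h.contDiffAt hx).differentiableAt (by simp)).hasFDerivAt
    refine h1.comp_hasDerivAt 0 ?_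
    simpa using ((hasDerivAt_id (0 : ℝ)).smul_const v).const_add x
  have h2 : ∀ᶠ t in 𝓝[>] (0 : ℝ), ρ (x + t • v) < 0 := by
    have := (hasDerivAt_iff_tendsto_slope.1 hd).mono_left
      (nhdsWithin_mono 0 (fun t (ht : 0 < t) => ht.ne'))
    filter_upwards [this.eventually_lt_const hv, self_mem_nhdsWithin] with t ht ht0
    simp only [slope_def_field, zero_smul, add_zero, h0, sub_zero] at ht
    exact (div_neg_iff.1 ht).resolve_left (fun h => absurd h.2 (not_lt.2 (le_of_lt ht0))) |>.1
  obtain ⟨t, ⟨ht, htU⟩, ht0⟩ := ((h2.and ((tendsto_line x v).eventually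
    (h.isOpen.mem_nhds hx))).and self_mem_nhdsWithin).exists
  have h3 := hsup _ (h.mem htU ht.le)
  rw [inner_add_right, real_inner_smul_right] at h3
  have h4 : t * inner ℝ θ v ≤ 0 := by linarith
  exact nonpos_of_mul_nonpos_right h4 ht0

/-- A linear form that is nonpositive where a second one is negative is a multiple of it. -/
theorem eq_div_mul_of_nonpos {f g : E →L[ℝ] ℝ} (h : ∀ v, f v < 0 → g v ≤ 0) {v₀ : E}
    (hv₀ : f v₀ < 0) (v : E) : g v = g v₀ / f v₀ * f v := by
  have hker : ∀ v, f v = 0 → g v ≤ 0 := by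
    intro v hv
    by_contra! hg
    -- The coefficient of `v₀` is small enough that `g` stays positive on the perturbed vector,
    -- while `f` becomes negative.
    have hc : 0 < g v / (|g v₀| + 1) := div_pos hg (by positivity)
    have h1 := h (v + (g v / (|g v₀| + 1)) • v₀) (by
      simp only [map_add, map_smul, smul_eq_mul, hv, zero_add]
      exact mul_neg_of_pos_of_neg hc hv₀)
    simp only [map_add, map_smul, smul_eq_mul] at h1
    have h2 : -|g v₀| ≤ g v₀ := neg_abs_le _
    have h3 : 0 < |g v₀| + 1 := by positivity
    have h4 : g v + g v / (|g v₀| + 1) * g v₀ = g v / (|g v₀| + 1) * (|g v₀| + 1 + g v₀) := by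
      field_simp
    rw [h4] at h1
    have := mul_pos hc (show 0 < |g v₀| + 1 + g v₀ by linarith)
    linarith
  have hne := hv₀.ne
  have h1 : f (v - (f v / f v₀) • v₀) = 0 := by simp [hne]
  have h2 := hker _ h1
  have h3 := hker (-(v - (f v / f v₀) • v₀)) (by rw [map_neg, h1, neg_zero])
  rw [map_neg] at h3
  have h4 : g (v - (f v / f v₀) • v₀) = 0 := by linarith
  rw [map_sub, map_smul, smul_eq_mul, sub_eq_zero] at h4
  rw [h4]; ring

theorem exists_apply_neg {f : E →L[ℝ] ℝ} (hf : f ≠ 0) : ∃ v, f v < 0 := by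
  obtain ⟨v, hv⟩ : ∃ v, f v ≠ 0 := by
    by_contra! h
    exact hf (by ext v; simpa using h v)
  rcases hv.lt_or_gt with h | h
  · exact ⟨v, h⟩
  · exact ⟨-v, by simpa using h⟩

theorem IsLocalDefining.inner_eq {K U : Set E} {ρ : E → ℝ} (h : IsLocalDefining K U ρ) {x θ : E}
    (hx : x ∈ U) (hK : x ∈ K) (hθ : θ ≠ 0) (hsup : ∀ y ∈ K, inner ℝ θ y ≤ inner ℝ θ x) {v₀ : E}
    (hv₀ : fderiv ℝ ρ x v₀ < 0) (v : E) :
    inner ℝ θ v = inner ℝ θ v₀ / fderiv ℝ ρ x v₀ * fderiv ℝ ρ x v :=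
  eq_div_mul_of_nonpos (g := innerSL ℝ θ)
    (fun _ hv => h.inner_nonpos hx hK hθ hsup hv) hv₀ v

theorem not_nonpos_of_deriv_deriv_pos {φ : ℝ → ℝ} (hc : ContDiffAt ℝ 2 φ 0) (h0 : φ 0 = 0)
    (h1 : deriv φ 0 = 0) (h2 : 0 < deriv (deriv φ) 0) : ∃ᶠ t in 𝓝[>] (0 : ℝ), 0 < φ t := by
  have hd : ∀ᶠ t in 𝓝 (0 : ℝ), DifferentiableAt ℝ φ t :=
    (hc.eventually (by simp)).mono fun t ht => ht.differentiableAt (by simp)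
  have hpos : ∀ᶠ t in 𝓝[>] (0 : ℝ), 0 < deriv φ t := by
    have hdd : HasDerivAt (deriv φ) (deriv (deriv φ) 0) 0 :=
      (differentiableAt_of_deriv_ne_zero h2.ne').hasDerivAt
    have := (hasDerivAt_iff_tendsto_slope.1 hdd).mono_left
      (nhdsWithin_mono 0 (fun t (ht : 0 < t) => ht.ne'))
    filter_upwards [this.eventually_const_lt h2, self_mem_nhdsWithin] with t ht ht0
    simp only [slope_def_field, h1, sub_zero] at ht
    exact (div_pos_iff_of_pos_right ht0).1 ht
  obtain ⟨ε, hε, hε'⟩ := (mem_nhdsGT_iff_exists_Ioo_subset).1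
    (hpos.and (hd.filter_mono nhdsWithin_le_nhds))
  have hd0 := hd.self_of_nhds
  have hmono : StrictMonoOn φ (Set.Ico 0 ε) := by
    refine strictMonoOn_of_deriv_pos (convex_Ico _ _) ?_ ?_
    · intro t ht
      rcases ht.1.eq_or_lt with rfl | h
      · exact hd0.continuousAt.continuousWithinAt
      · exact (hε' ⟨h, ht.2⟩).2.continuousAt.continuousWithinAt
    · intro t ht
      rw [interior_Ico] at ht
      exact (hε' ht).1
  refine Eventually.frequently ?_
  filter_upwards [Ioo_mem_nhdsGT hε] with t ht
  rw [← h0]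
  exact hmono ⟨le_rfl, hε⟩ ⟨ht.1.le, ht.2⟩ ht.1

/-- Otherwise the segment from `x` to `y` lies in `K` and is tangent to the boundary at `x`. Along
it `ρ` vanishes to first order and has positive second derivative, so it becomes positive inside
`K`. -/
theorem IsLocalDefining.eq_of_support {K U : Set E} {ρ : E → ℝ} (h : IsLocalDefining K U ρ)
    (hcv : Convex ℝ K) {x θ : E} (hx : x ∈ U) (hK : x ∈ K) (hθ : θ ≠ 0)
    (hsup : ∀ y ∈ K, inner ℝ θ y ≤ inner ℝ θ x) (hne : fderiv ℝ ρ x ≠ 0)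
    (hpos : ∀ v : E, v ≠ 0 → fderiv ℝ ρ x v = 0 → 0 < fderiv ℝ (fderiv ℝ ρ) x v v) {y : E}
    (hy : y ∈ K) (hysup : ∀ z ∈ K, inner ℝ θ z ≤ inner ℝ θ y) : y = x := by
  by_contra hxy
  obtain ⟨v₀, hv₀⟩ := exists_apply_neg hne
  have hin := h.inner_eq hx hK hθ hsup hv₀
  have hv : y - x ≠ 0 := sub_ne_zero.2 hxy
  have hμ : inner ℝ θ v₀ / fderiv ℝ ρ x v₀ ≠ 0 := by
    intro h0
    have := hin θ
    rw [h0, zero_mul] at this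
    exact hθ (inner_self_eq_zero.1 this)
  have h1 : fderiv ℝ ρ x (y - x) = 0 := by
    have h2 := hin (y - x)
    rw [inner_sub_right, le_antisymm (hsup y hy) (hysup x hK), sub_self] at h2
    exact (mul_eq_zero.1 h2.symm).resolve_left hμ
  have hcd := h.contDiffAt hx
  have hline : ∀ t : ℝ, HasDerivAt (fun t : ℝ => x + t • (y - x)) (y - x) t := fun t => by
    simpa using ((hasDerivAt_id t).smul_const (y - x)).const_add x
  have hx0 : x + (0 : ℝ) • (y - x) = x := by simp
  have hcont : Tendsto (fun t : ℝ => x + t • (y - x)) (𝓝 0) (𝓝 x) := by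
    have := (hline 0).continuousAt.tendsto
    rwa [hx0] at this
  have hder : (deriv fun t : ℝ => ρ (x + t • (y - x))) =ᶠ[𝓝 0]
      fun t => fderiv ℝ ρ (x + t • (y - x)) (y - x) := by
    filter_upwards [hcont.eventually (h.isOpen.mem_nhds hx)] with t ht
    exact (((h.contDiffAt ht).differentiableAt (by simp)).hasFDerivAt.comp_hasDerivAt t
      (hline t)).deriv
  have hf2 : HasFDerivAt (fderiv ℝ ρ) (fderiv ℝ (fderiv ℝ ρ) x) x :=
    ((hcd.fderiv_right (m := 1) (by norm_cast)).differentiableAt (by simp)).hasFDerivAt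
  have hder2 : HasDerivAt (fun t : ℝ => fderiv ℝ ρ (x + t • (y - x)) (y - x))
      (fderiv ℝ (fderiv ℝ ρ) x (y - x) (y - x)) 0 := by
    have h3 : HasDerivAt (fun t : ℝ => fderiv ℝ ρ (x + t • (y - x)))
        (fderiv ℝ (fderiv ℝ ρ) x (y - x)) 0 := by
      refine HasFDerivAt.comp_hasDerivAt (0 : ℝ) ?_ (hline 0)
      rwa [hx0]
    simpa using h3.clm_apply (hasDerivAt_const (0 : ℝ) (y - x))
  have hfr := not_nonpos_of_deriv_deriv_pos (φ := fun t : ℝ => ρ (x + t • (y - x))) ?_ ?_ ?_ ?_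
  · refine hfr ?_
    have hev := (hcont.mono_left (nhdsWithin_le_nhds (s := Set.Ioi 0))).eventually
      (h.isOpen.mem_nhds hx)
    filter_upwards [hev, Ioo_mem_nhdsGT one_pos] with t ht ht01
    refine not_lt.2 (h.le_zero ht ?_)
    exact hcv.add_smul_sub_mem hK hy ⟨ht01.1.le, ht01.2.le⟩
  · refine ContDiffAt.comp (0 : ℝ) (g := ρ) ?_ (by fun_prop)
    rw [hx0]
    exact hcd.of_le (by norm_cast)
  · simpa using h.eq_zero hx hK hθ hsup
  · rw [hder.self_of_nhds]
    show fderiv ℝ ρ (x + (0 : ℝ) • (y - x)) (y - x) = 0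
    rw [hx0, h1]
  · rw [hder.deriv_eq, hder2.deriv]
    exact hpos _ hv h1

end Existence

/-! ### Smoothness of the support map -/

section Smoothness

variable {E : Type*} [NormedAddCommGroup E] [InnerProductSpace ℝ E]

/-- Any cluster point of `P` at `θ` still maximizes `⟪θ, ·⟫` over `K`, so by uniqueness it is `P θ`;
compactness concludes. -/
theorem continuousAt_of_isMaxOn_inner {K : Set E} (hK : IsCompact K) {P : E → E}
    (hmem : ∀ θ, θ ≠ 0 → P θ ∈ K)
    (hle : ∀ θ, θ ≠ 0 → ∀ y ∈ K, inner ℝ θ y ≤ inner ℝ θ (P θ))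
    (heq : ∀ θ, θ ≠ 0 → ∀ x ∈ K, (∀ y ∈ K, inner ℝ θ y ≤ inner ℝ θ x) → x = P θ)
    {θ : E} (hθ : θ ≠ 0) : ContinuousAt P θ := by
  have hev : ∀ᶠ u in 𝓝 θ, u ≠ 0 := isOpen_ne.mem_nhds hθ
  refine hK.tendsto_nhds_of_unique_mapClusterPt (hev.mono hmem) fun y hy hcl => ?_
  refine heq θ hθ y hy fun z hz => ?_
  obtain ⟨U, hU, hUt⟩ := mapClusterPt_iff_ultrafilter.1 hcl
  have hid : Tendsto (fun u : E => u) U (𝓝 θ) := hU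
  refine le_of_tendsto_of_tendsto (hid.inner (tendsto_const_nhds (x := z))) (hid.inner hUt) ?_
  exact (hev.filter_mono hU).mono fun u hu => hle u hu z hz

variable [FiniteDimensional ℝ E]

theorem finrank_strongDual : Module.finrank ℝ (E →L[ℝ] ℝ) = Module.finrank ℝ E := by
  rw [← (LinearMap.toContinuousLinearMap : (E →ₗ[ℝ] ℝ) ≃ₗ[ℝ] (E →L[ℝ] ℝ)).finrank_eq]
  exact Subspace.dual_finrank_eq

/-- A continuous linear map between spaces of the same finite dimension with trivial kernel, as a
continuous linear equivalence. -/
def equivOfInjective {X Y : Type*} [NormedAddCommGroup X] [NormedSpace ℝ X]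
    [FiniteDimensional ℝ X] [NormedAddCommGroup Y] [NormedSpace ℝ Y] [FiniteDimensional ℝ Y]
    (f : X →L[ℝ] Y) (hf : ∀ x, f x = 0 → x = 0) (hd : Module.finrank ℝ X = Module.finrank ℝ Y) :
    X ≃L[ℝ] Y :=
  (LinearMap.linearEquivOfInjective (f : X →ₗ[ℝ] Y)
    ((injective_iff_map_eq_zero (f : X →ₗ[ℝ] Y)).2 hf) hd).toContinuousLinearEquiv

theorem coe_equivOfInjective {X Y : Type*} [NormedAddCommGroup X] [NormedSpace ℝ X]
    [FiniteDimensional ℝ X] [NormedAddCommGroup Y] [NormedSpace ℝ Y] [FiniteDimensional ℝ Y]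
    (f : X →L[ℝ] Y) (hf : ∀ x, f x = 0 → x = 0) (hd : Module.finrank ℝ X = Module.finrank ℝ Y) :
    (equivOfInjective f hf hd : X →L[ℝ] Y) = f := by
  ext x; rfl

/-- A smooth map with injective derivative between spaces of the same dimension has a smooth local
left inverse. -/
theorem exists_smooth_leftInverse {X Y : Type*} [NormedAddCommGroup X] [NormedSpace ℝ X]
    [FiniteDimensional ℝ X] [NormedAddCommGroup Y] [NormedSpace ℝ Y] [FiniteDimensional ℝ Y]
    {G : X → Y} {G' : X →L[ℝ] Y} {a : X} (hG : ContDiffAt ℝ ∞ G a) (hG' : HasFDerivAt G G' a)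
    (hinj : ∀ x, G' x = 0 → x = 0) (hd : Module.finrank ℝ X = Module.finrank ℝ Y) :
    ∃ L : Y → X, ContDiffAt ℝ ∞ L (G a) ∧ ∀ᶠ x in 𝓝 a, L (G x) = x := by
  have : CompleteSpace X := FiniteDimensional.complete ℝ X
  have hG'' : HasFDerivAt G (equivOfInjective G' hinj hd : X →L[ℝ] Y) a := by
    rwa [coe_equivOfInjective]
  refine ⟨hG.localInverse hG'' (by simp), hG.to_localInverse hG'' (by simp), ?_⟩
  exact (hG.hasStrictFDerivAt' hG'' (by simp)).eventually_left_inverse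

/-- The inner product as a continuous linear map to the dual space. -/
def innerDual (E : Type*) [NormedAddCommGroup E] [InnerProductSpace ℝ E] [FiniteDimensional ℝ E] :
    E →L[ℝ] (E →L[ℝ] ℝ) :=
  LinearMap.toContinuousLinearMap
    ((LinearMap.toContinuousLinearMap : (E →ₗ[ℝ] ℝ) ≃ₗ[ℝ] (E →L[ℝ] ℝ)).toLinearMap ∘ₗ innerₗ E)

/-- The point `x = P u` and a multiplier `μ` solve `μ dρ(x) = ⟪u, ·⟫`, `ρ(x) = 0`. The map `(x, μ) ↦
(μ dρ(x), ρ(x))` has a smooth local left inverse, and the continuity of `P` guarantees that `(P u, μ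
u)` stays where that inverse applies. -/
theorem contDiffAt_of_support {K U : Set E} {ρ : E → ℝ} (h : IsLocalDefining K U ρ)
    {P : E → E} (hmem : ∀ θ, θ ≠ 0 → P θ ∈ K)
    (hle : ∀ θ, θ ≠ 0 → ∀ y ∈ K, inner ℝ θ y ≤ inner ℝ θ (P θ)) {θ : E} (hθ : θ ≠ 0)
    (hP : ContinuousAt P θ) (hx : P θ ∈ U) (hne : fderiv ℝ ρ (P θ) ≠ 0)
    (hpos : ∀ v : E, v ≠ 0 → fderiv ℝ ρ (P θ) v = 0 → 0 < fderiv ℝ (fderiv ℝ ρ) (P θ) v v) :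
    ContDiffAt ℝ ∞ P θ := by
  obtain ⟨v₀, hv₀⟩ := exists_apply_neg hne
  have hcd := h.contDiffAt hx
  have hcd1 : ContDiffAt ℝ ∞ (fderiv ℝ ρ) (P θ) := hcd.fderiv_right (by simp)
  set μ : E → ℝ := fun u => inner ℝ u v₀ / fderiv ℝ ρ (P u) v₀ with hμ
  have hin := h.inner_eq hx (hmem θ hθ) hθ (hle θ hθ) hv₀
  have hμ0 : μ θ ≠ 0 := by
    intro h0
    have := hin θ
    change _ = μ θ * _ at this
    rw [h0, zero_mul] at this
    exact hθ (inner_self_eq_zero.1 this)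
  have hd1 : HasFDerivAt (fun q : E × ℝ => fderiv ℝ ρ q.1)
      (fderiv ℝ (fderiv ℝ ρ) (P θ) ∘L ContinuousLinearMap.fst ℝ E ℝ) (P θ, μ θ) :=
    HasFDerivAt.comp (P θ, μ θ) (g := fderiv ℝ ρ)
      ((hcd1.differentiableAt (by simp)).hasFDerivAt) hasFDerivAt_fst
  have hd2 : HasFDerivAt (fun q : E × ℝ => ρ q.1)
      (fderiv ℝ ρ (P θ) ∘L ContinuousLinearMap.fst ℝ E ℝ) (P θ, μ θ) :=
    HasFDerivAt.comp (P θ, μ θ) (g := ρ)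
      ((hcd.differentiableAt (by simp)).hasFDerivAt) hasFDerivAt_fst
  have hd0 : HasFDerivAt (fun q : E × ℝ => q.2) (ContinuousLinearMap.snd ℝ E ℝ) (P θ, μ θ) :=
    hasFDerivAt_snd
  have hd := (hd0.smul hd1).prodMk hd2
  have hcdG : ContDiffAt ℝ ∞ (fun q : E × ℝ => (q.2 • fderiv ℝ ρ q.1, ρ q.1)) (P θ, μ θ) := by
    have h1 : ContDiffAt ℝ ∞ (fun q : E × ℝ => fderiv ℝ ρ q.1) (P θ, μ θ) :=
      ContDiffAt.comp (P θ, μ θ) (g := fderiv ℝ ρ) hcd1 contDiffAt_fst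
    have h2 : ContDiffAt ℝ ∞ (fun q : E × ℝ => ρ q.1) (P θ, μ θ) :=
      ContDiffAt.comp (P θ, μ θ) (g := ρ) hcd contDiffAt_fst
    have h3 : ContDiffAt ℝ ∞ (fun q : E × ℝ => q.2) (P θ, μ θ) := contDiffAt_snd
    exact (h3.smul h1).prodMk h2
  -- A kernel vector `(y, m)` satisfies `dρ y = 0` and `μ D²ρ y + m dρ = 0`. Evaluating the latter
  -- at `y` gives `μ D²ρ(y, y) = 0`, so `y = 0` by curvature, and then `m = 0` since `dρ ≠ 0`.
  obtain ⟨L, hL, hLi⟩ := exists_smooth_leftInverse hcdG hd (by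
    rintro ⟨y, m⟩ hym
    rw [ContinuousLinearMap.prod_apply, Prod.mk_eq_zero] at hym
    obtain ⟨h1, h2⟩ := hym
    have h2' : fderiv ℝ ρ (P θ) y = 0 := h2
    have h1' : μ θ • fderiv ℝ (fderiv ℝ ρ) (P θ) y + m • fderiv ℝ ρ (P θ) = 0 := by
      simpa using h1
    have hy : y = 0 := by
      by_contra hy
      have h3 := DFunLike.congr_fun h1' y
      simp only [add_apply, smul_apply, h2', smul_eq_mul,
        mul_zero, add_zero, zero_apply] at h3
      exact (mul_ne_zero hμ0 (hpos y hy h2').ne') h3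
    rw [hy, map_zero, smul_zero, zero_add] at h1'
    rw [hy, (smul_eq_zero.1 h1').resolve_right hne]
    rfl) (by simp [finrank_strongDual])
  have hG0 : ∀ u, u ≠ 0 → P u ∈ U → fderiv ℝ ρ (P u) v₀ < 0 →
      (μ u • fderiv ℝ ρ (P u), ρ (P u)) = (innerDual E u, 0) := by
    intro u hu huU huv
    ext1
    · ext v
      exact (h.inner_eq huU (hmem u hu) hu (hle u hu) huv v).symm
    · exact h.eq_zero huU (hmem u hu) hu (hle u hu)
  have hcf : ContinuousAt (fun u => fderiv ℝ ρ (P u) v₀) θ :=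
    (ContinuousAt.comp (g := fderiv ℝ ρ) hcd1.continuousAt hP).clm_apply continuousAt_const
  have hμc : ContinuousAt μ θ :=
    (continuousAt_id.inner continuousAt_const).div hcf hv₀.ne
  have hev := (hP.prodMk hμc).eventually hLi
  rw [hG0 θ hθ hx hv₀] at hL
  have hfin : ContDiffAt ℝ ∞ (fun u => (L (innerDual E u, 0)).1) θ := by
    refine contDiffAt_fst.comp θ (ContDiffAt.comp θ (g := L) hL ?_)
    exact (innerDual E).contDiff.contDiffAt.prodMk contDiffAt_const
  refine hfin.congr_of_eventuallyEq ?_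
  filter_upwards [hev, isOpen_ne.mem_nhds hθ, hP.eventually (h.isOpen.mem_nhds hx),
    hcf.eventually_lt_const hv₀] with u hu hu0 huU huv
  rw [← hG0 u hu0 huU huv, hu]

end Smoothness

theorem HasSmoothPositivelyCurvedBoundaryAt.exists_isLocalDefining {d : ℕ}
    {K : Set (EuclideanSpace ℝ (Fin d))} {x : EuclideanSpace ℝ (Fin d)}
    (h : HasSmoothPositivelyCurvedBoundaryAt K x) : ∃ U ρ, IsLocalDefining K U ρ ∧ x ∈ U ∧
      fderiv ℝ ρ x ≠ 0 ∧ ∀ v : EuclideanSpace ℝ (Fin d), v ≠ 0 → fderiv ℝ ρ x v = 0 →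
      0 < fderiv ℝ (fderiv ℝ ρ) x v v := by
  obtain ⟨U, ρ, hU, hx, hρ, hK, h1, h2⟩ := h
  exact ⟨U, ρ, ⟨hU, hρ, hK⟩, hx, h1, h2⟩

theorem mem_frontier_of_support {E : Type*} [NormedAddCommGroup E] [InnerProductSpace ℝ E]
    {K : Set E} {x θ : E} (hK : x ∈ K) (hθ : θ ≠ 0)
    (hsup : ∀ y ∈ K, inner ℝ θ y ≤ inner ℝ θ x) : x ∈ frontier K := by
  refine ⟨subset_closure hK, fun hi => ?_⟩
  obtain ⟨t, ht, ht0⟩ := (((tendsto_line x θ).eventually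
    (mem_interior_iff_mem_nhds.1 hi)).and self_mem_nhdsWithin).exists
  have h2 := hsup _ ht
  rw [inner_add_right, real_inner_smul_right] at h2
  have : 0 < t * inner ℝ θ θ := mul_pos ht0 (real_inner_self_pos.2 hθ)
  linarith

theorem IsSmoothStrictlyConvex.exists_isSupportMap {d : ℕ} {K : Set (EuclideanSpace ℝ (Fin d))}
    (hK : IsSmoothStrictlyConvex K) : ∃ P, IsSupportMap K P := by
  rcases hK.point_or_curved with ⟨a, rfl⟩ | hcur
  · exact ⟨_, IsSupportMap.singleton a⟩
  have hex : ∀ θ : EuclideanSpace ℝ (Fin d), ∃ x ∈ K, ∀ y ∈ K, inner ℝ θ y ≤ inner ℝ θ x := by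
    intro θ
    obtain ⟨x, hx, hmax⟩ := hK.isCompact.exists_isMaxOn hK.nonempty
      (f := fun y => inner ℝ θ y) (by fun_prop)
    exact ⟨x, hx, fun y hy => hmax hy⟩
  choose P hP hle using hex
  have heq : ∀ θ, θ ≠ 0 → ∀ x ∈ K, (∀ y ∈ K, inner ℝ θ y ≤ inner ℝ θ x) → x = P θ := by
    intro θ hθ x hx hsup
    obtain ⟨U, ρ, h, hU, hne, hpos⟩ :=
      (hcur _ (mem_frontier_of_support (hP θ) hθ (hle θ))).exists_isLocalDefining
    exact h.eq_of_support hK.convex hU (hP θ) hθ (hle θ) hne hpos hx hsup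
  refine ⟨P, fun _ => hP _, fun _ => hle _, fun {θ} => heq θ, fun {θ} hθ => ?_⟩
  obtain ⟨U, ρ, h, hU, hne, hpos⟩ :=
    (hcur _ (mem_frontier_of_support (hP θ) hθ (hle θ))).exists_isLocalDefining
  exact contDiffAt_of_support h (fun θ _ => hP θ) (fun θ _ => hle θ) hθ
    (continuousAt_of_isMaxOn_inner hK.isCompact (fun θ _ => hP θ) (fun θ _ => hle θ) heq hθ)
    hU hne hpos

/-! ## Steiner's formula -/

section PolynomialIntegral

/-- Lagrange interpolation at the positive nodes `1, …, n + 1` expresses `f t` as a fixed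
combination of the integrable functions `f 1, …, f (n + 1)`. No measurability of the coefficients of
the polynomials is needed. -/
theorem exists_polynomial_integral_eq {α : Type*} [MeasurableSpace α] {μ : Measure α} {n : ℕ}
    {f : ℝ → α → ℝ}
    (hf : ∀ᵐ a ∂μ, ∃ p : Polynomial ℝ, p.natDegree ≤ n ∧ ∀ t, 0 < t → f t a = p.eval t)
    (hint : ∀ t, 0 < t → Integrable (f t) μ) :
    ∃ Q : Polynomial ℝ, Q.natDegree ≤ n ∧ ∀ t, 0 < t → ∫ a, f t a ∂μ = Q.eval t := by
  set s := Finset.range (n + 1)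
  set v : ℕ → ℝ := fun i => (i : ℝ) + 1 with hv
  have hinj : Set.InjOn v s := fun i _ j _ h => by simpa [hv] using h
  have hpos : ∀ i, 0 < v i := fun i => by simp only [hv]; positivity
  refine ⟨Lagrange.interpolate s v fun i => ∫ a, f (v i) a ∂μ, ?_, fun t ht => ?_⟩
  · refine Polynomial.natDegree_le_iff_coeff_eq_zero.2 fun N hN => ?_
    have h := Lagrange.degree_interpolate_lt (s := s) (v := v) (fun i => ∫ a, f (v i) a ∂μ) hinj
    rw [Finset.card_range] at h
    exact Polynomial.coeff_eq_zero_of_degree_lt (h.trans_le (by exact_mod_cast hN))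
  · have h1 : ∀ᵐ a ∂μ, f t a = ∑ i ∈ s, f (v i) a * (Lagrange.basis s v i).eval t := by
      filter_upwards [hf] with a ⟨p, hp, hpe⟩
      have h2 : p.degree < s.card := by
        rw [Finset.card_range]
        exact lt_of_le_of_lt (Polynomial.degree_le_of_natDegree_le hp) (by exact_mod_cast n.lt_succ_self)
      have h3 := Lagrange.eq_interpolate hinj h2
      rw [hpe t ht, h3, Lagrange.interpolate_apply, Polynomial.eval_finsetSum]
      refine Finset.sum_congr rfl fun i _ => ?_
      rw [Polynomial.eval_mul, Polynomial.eval_C, hpe _ (hpos i)]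
    rw [integral_congr_ae h1, integral_finsetSum _ fun i _ => (hint _ (hpos i)).mul_const _,
      Lagrange.interpolate_apply, Polynomial.eval_finsetSum]
    refine Finset.sum_congr rfl fun i _ => ?_
    rw [Polynomial.eval_mul, Polynomial.eval_C, integral_mul_const]

end PolynomialIntegral

/-! ### Volume of the collar around a convex body -/

section Steiner

variable {E : Type*} [NormedAddCommGroup E] [InnerProductSpace ℝ E]

/-- The determinant is the characteristic polynomial of `-H` at `t`. Since `H` is monotone, `H + t`
is injective for `t > 0`, so this polynomial has constant sign on the half-line and its absolute
value there is a polynomial too. -/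
theorem exists_polynomial_abs_det_eq [FiniteDimensional ℝ E] {H : E →L[ℝ] E} (hH : ∀ x, 0 ≤ inner ℝ (H x) x) :
    ∃ p : Polynomial ℝ, p.natDegree ≤ Module.finrank ℝ E ∧
      ∀ t, 0 < t → |(H + t • ContinuousLinearMap.id ℝ E).det| = p.eval t := by
  set p := (-(H : E →ₗ[ℝ] E)).charpoly with hp
  have heval : ∀ t, p.eval t = (H + t • ContinuousLinearMap.id ℝ E).det := by
    intro t
    rw [hp, LinearMap.eval_charpoly, ContinuousLinearMap.det]
    congr 1
    ext x
    simp [Algebra.algebraMap_eq_smul_one, add_comm]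
  have hne : ∀ t, 0 < t → p.eval t ≠ 0 := by
    intro t ht h0
    rw [heval, ContinuousLinearMap.det] at h0
    obtain ⟨x, hx, hx0⟩ := (Submodule.ne_bot_iff _).1 (LinearMap.bot_lt_ker_of_det_eq_zero h0).ne'
    have h1 : H x + t • x = 0 := by simpa using hx
    have h2 : inner ℝ (H x) x + t * inner ℝ x x = 0 := by
      rw [← real_inner_smul_left, ← inner_add_left, h1, inner_zero_left]
    have := mul_pos ht (real_inner_self_pos.2 hx0)
    linarith [hH x]
  have hdeg : p.natDegree = Module.finrank ℝ E := LinearMap.charpoly_natDegree _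
  have hsign : (∀ t, 0 < t → 0 < p.eval t) ∨ ∀ t, 0 < t → p.eval t < 0 := by
    by_contra! hcon
    obtain ⟨⟨a, ha, ha'⟩, b, hb, hb'⟩ := hcon
    have hpre : IsPreconnected ((fun t => p.eval t) '' Set.Ioi 0) :=
      isPreconnected_Ioi.image _ p.continuous.continuousOn
    obtain ⟨t, ht, ht0⟩ := hpre.ordConnected.out ⟨a, ha, rfl⟩ ⟨b, hb, rfl⟩ ⟨ha', hb'⟩
    exact hne t ht ht0
  rcases hsign with h | h
  · exact ⟨p, hdeg.le, fun t ht => by rw [← heval, abs_of_pos (h t ht)]⟩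
  · exact ⟨-p, by rw [Polynomial.natDegree_neg, hdeg], fun t ht => by
      rw [← heval, abs_of_neg (h t ht), Polynomial.eval_neg]⟩

theorem IsSupportMap.inner_fderiv_nonneg {K : Set E} {P : E → E} (hP : IsSupportMap K P) {u : E}
    (hu : u ≠ 0) (x : E) : 0 ≤ inner ℝ (fderiv ℝ P u x) x := by
  have hd : HasDerivAt (fun t : ℝ => P (u + t • x)) (fderiv ℝ P u x) 0 := by
    have h1 : HasFDerivAt P (fderiv ℝ P u) (u + (0 : ℝ) • x) := by
      simpa using ((hP.contDiffAt hu).differentiableAt (by simp)).hasFDerivAt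
    refine h1.comp_hasDerivAt 0 ?_
    simpa using ((hasDerivAt_id (0 : ℝ)).smul_const x).const_add u
  have ht : Tendsto (slope (fun t : ℝ => P (u + t • x)) 0) (𝓝[>] 0) (𝓝 (fderiv ℝ P u x)) :=
    (hasDerivAt_iff_tendsto_slope.1 hd).mono_left
      (nhdsWithin_mono 0 (fun t (ht : 0 < t) => ht.ne'))
  refine ge_of_tendsto (ht.inner tendsto_const_nhds) ?_
  filter_upwards [self_mem_nhdsWithin, (tendsto_line u x).eventually (isOpen_ne.mem_nhds hu)]
    with t ht0 htu
  have h := hP.inner_sub_nonneg htu hu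
  rw [add_sub_cancel_left, real_inner_smul_right] at h
  rw [slope_def_module, real_inner_smul_left]
  simp only [zero_smul, add_zero, sub_zero]
  exact mul_nonneg (inv_nonneg.2 ht0.le) (nonneg_of_mul_nonneg_right h ht0)

theorem mem_add_smul_closedBall_iff {K : Set E} (hc : IsCompact K) (hn : K.Nonempty) {t : ℝ}
    (ht : 0 < t) {v : E} : v ∈ K + t • Metric.closedBall (0 : E) 1 ↔ Metric.infDist v K ≤ t := by
  rw [smul_unitClosedBall_of_nonneg ht.le]
  constructor
  · rintro ⟨x, hx, y, hy, rfl⟩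
    have h := Metric.infDist_le_dist_of_mem (x := x + y) hx
    simp only [dist_self_add_left] at h
    exact h.trans (by simpa using hy)
  · intro h
    obtain ⟨y, hy, hd⟩ := hc.exists_infDist_eq_dist hn v
    refine ⟨y, hy, v - y, ?_, by simp⟩
    rw [mem_closedBall_zero_iff, ← dist_eq_norm, ← hd]
    exact h

/-- As `P` is constant on rays, `P u + t u` is the point at distance `t‖u‖` from `K` with nearest
point `P u`. Letting `u` run over the whole punctured ball, instead of the sphere, covers the full
collar and avoids surface measure. -/
theorem IsSupportMap.image_eq {K : Set E} {P : E → E} (hP : IsSupportMap K P)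
    (hc : IsCompact K) (hn : K.Nonempty) (hcv : Convex ℝ K) {t : ℝ} (ht : 0 < t) :
    (fun u => P u + t • u) '' (Metric.closedBall (0 : E) 1 \ {0}) =
      (K + t • Metric.closedBall (0 : E) 1) \ K := by
  ext v
  rw [Set.mem_sdiff, mem_add_smul_closedBall_iff hc hn ht]
  constructor
  · rintro ⟨u, ⟨hu, hu0⟩, rfl⟩
    have htu : t • u ≠ 0 := smul_ne_zero ht.ne' hu0
    have h := hP.infDist htu
    rw [hP.smul hu0 ht, add_comm] at h
    simp only
    constructor
    · rw [h, norm_smul, Real.norm_of_nonneg ht.le]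
      exact mul_le_of_le_one_right ht.le (by simpa using hu)
    · intro hK
      rw [Metric.infDist_zero_of_mem hK] at h
      exact htu (norm_eq_zero.1 h.symm)
  · rintro ⟨hv, hvK⟩
    obtain ⟨w, hw, rfl⟩ := hP.exists_add_eq hc hn hcv hvK
    rw [hP.infDist hw] at hv
    refine ⟨t⁻¹ • w, ⟨?_, smul_ne_zero (inv_ne_zero ht.ne') hw⟩, ?_⟩
    · rw [mem_closedBall_zero_iff, norm_smul, norm_inv, Real.norm_of_nonneg ht.le,
        inv_mul_le_iff₀ ht]
      simpa using hv
    · simp only [hP.smul hw (inv_pos.2 ht), smul_inv_smul₀ ht.ne']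
      exact add_comm _ _

/-- Change variables by `u ↦ P u + t u`, which is injective by monotonicity of `P`, and integrate
the Jacobian, a polynomial in `t` at each point. The constant `μ K` accounts for the body itself. -/
theorem IsSupportMap.exists_polynomial_volume [FiniteDimensional ℝ E] [MeasurableSpace E]
    [BorelSpace E] (μ : Measure E) [μ.IsAddHaarMeasure] {K : Set E}
    {P : E → E} (hP : IsSupportMap K P) (hc : IsCompact K) (hn : K.Nonempty) (hcv : Convex ℝ K) :
    ∃ Q : Polynomial ℝ, Q.natDegree ≤ Module.finrank ℝ E ∧ ∀ t, 0 < t →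
      μ.real (K + t • Metric.closedBall (0 : E) 1) = Q.eval t := by
  have hms : MeasurableSet (Metric.closedBall (0 : E) 1 \ {0}) :=
    Metric.isClosed_closedBall.measurableSet.diff (measurableSet_singleton 0)
  have hd : ∀ t : ℝ, ∀ u ∈ Metric.closedBall (0 : E) 1 \ {0},
      HasFDerivWithinAt (fun u => P u + t • u) (fderiv ℝ P u + t • ContinuousLinearMap.id ℝ E)
        (Metric.closedBall (0 : E) 1 \ {0}) u := fun t u hu =>
    ((((hP.contDiffAt hu.2).differentiableAt (by simp)).hasFDerivAt).add
      ((hasFDerivAt_id u).const_smul t)).hasFDerivWithinAt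
  have hinj : ∀ t : ℝ, 0 < t →
      Set.InjOn (fun u => P u + t • u) (Metric.closedBall (0 : E) 1 \ {0}) := by
    intro t ht u hu u' hu' h
    have h1 := hP.inner_sub_nonneg hu.2 hu'.2
    have h2 : P u - P u' = -(t • (u - u')) := by
      have h3 : P u + t • u = P u' + t • u' := h
      rw [smul_sub, neg_sub, sub_eq_sub_iff_add_eq_add, h3, add_comm]
    rw [h2, inner_neg_left, real_inner_smul_left] at h1
    by_contra hne
    have := mul_pos ht (real_inner_self_pos.2 (sub_ne_zero.2 hne))
    linarith
  have hcomp : ∀ t : ℝ, 0 < t → IsCompact (K + t • Metric.closedBall (0 : E) 1) := fun t ht =>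
    hc.add ((isCompact_closedBall 0 1).smul t)
  have hint : ∀ t : ℝ, 0 < t → IntegrableOn
      (fun u => |(fderiv ℝ P u + t • ContinuousLinearMap.id ℝ E).det|)
      (Metric.closedBall (0 : E) 1 \ {0}) μ := by
    intro t ht
    have h := (integrableOn_image_iff_integrableOn_abs_det_fderiv_smul μ hms (hd t) (hinj t ht)
      (fun _ => (1 : ℝ))).1 (by
        rw [hP.image_eq hc hn hcv ht]
        exact integrableOn_const ((measure_mono Set.sdiff_subset).trans_lt
          (hcomp t ht).measure_lt_top).ne)
    simpa using h
  obtain ⟨Q, hQ, hQe⟩ := exists_polynomial_integral_eq (n := Module.finrank ℝ E)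
    (f := fun t u => |(fderiv ℝ P u + t • ContinuousLinearMap.id ℝ E).det|)
    (μ := μ.restrict (Metric.closedBall (0 : E) 1 \ {0}))
    ((ae_restrict_mem hms).mono fun u hu =>
      exists_polynomial_abs_det_eq (hP.inner_fderiv_nonneg hu.2)) hint
  refine ⟨Q + Polynomial.C (μ.real K), ?_, fun t ht => ?_⟩
  · exact (Polynomial.natDegree_add_le _ _).trans (by simpa using hQ)
  · have hsub : K ⊆ K + t • Metric.closedBall (0 : E) 1 := fun x hx => by
      rw [mem_add_smul_closedBall_iff hc hn ht, Metric.infDist_zero_of_mem hx]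
      exact ht.le
    have h1 := integral_image_eq_integral_abs_det_fderiv_smul μ hms (hd t) (hinj t ht)
      (fun _ => (1 : ℝ))
    rw [hP.image_eq hc hn hcv ht, setIntegral_const] at h1
    simp only [smul_eq_mul, mul_one] at h1
    rw [Polynomial.eval_add, Polynomial.eval_C, ← hQe t ht, ← h1,
      measureReal_sdiff hsub hc.measurableSet (hcomp t ht).measure_lt_top.ne]
    ring

end Steiner

theorem steinerFormula_of_polynomial {d : ℕ} {K : Set (EuclideanSpace ℝ (Fin d))}
    {Q : Polynomial ℝ} (hQ : Q.natDegree ≤ d)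
    (h : ∀ t, 0 < t → volume.real (K + t • Metric.closedBall (0 : EuclideanSpace ℝ (Fin d)) 1) =
      Q.eval t) : ∃ V, SteinerFormula K V := by
  refine ⟨fun j => Q.coeff (d - j) / (Real.pi ^ (((d - j : ℕ) : ℝ) / 2) /
    Real.Gamma (((d - j : ℕ) : ℝ) / 2 + 1)), fun t ht => ?_⟩
  rw [h t ht, Polynomial.eval_eq_sum_range' (Nat.lt_succ_of_le hQ)]
  refine Finset.sum_congr rfl fun l hl => ?_
  have hl' : d - (d - l) = l := Nat.sub_sub_self (Nat.lt_succ_iff.1 (Finset.mem_range.1 hl))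
  have h1 : 0 < Real.Gamma ((l : ℝ) / 2 + 1) := Real.Gamma_pos_of_pos (by positivity)
  have h2 : 0 < Real.pi ^ ((l : ℝ) / 2) := Real.rpow_pos_of_pos Real.pi_pos _
  simp only [hl']
  field_simp

theorem steinerFormula_intrinsicVolume {d : ℕ} {K : Set (EuclideanSpace ℝ (Fin d))}
    (h : ∃ V, SteinerFormula K V) : SteinerFormula K (intrinsicVolume K) := by
  have : intrinsicVolume K = h.choose := by
    funext j
    rw [intrinsicVolume, dif_pos h]
  rw [this]
  exact h.choose_spec

/-! ## Iterated differences -/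

section IteratedDiff

/-- The iterated difference of `g`, with steps the elements of a list. -/
def iteratedDiff {X F : Type*} [Add X] [Sub F] : List X → (X → F) → X → F
  | [], g => g
  | h :: l, g => iteratedDiff l fun x => g x - g (x + h)

theorem iteratedDiff_sub {X F : Type*} [Add X] [AddCommGroup F] (l : List X) (f g : X → F) (x : X) :
    iteratedDiff l (fun x => f x - g x) x = iteratedDiff l f x - iteratedDiff l g x := by
  induction l generalizing f g with
  | nil => rfl
  | cons h l ih =>
    simp only [iteratedDiff]
    rw [← ih]
    congr 1
    funext y
    abel

theorem iteratedDiff_comp_add {X F : Type*} [AddCommGroup X] [AddCommGroup F] (l : List X)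
    (g : X → F) (h x : X) : iteratedDiff l (fun x => g (x + h)) x = iteratedDiff l g (x + h) := by
  induction l generalizing g with
  | nil => rfl
  | cons k l ih =>
    simp only [iteratedDiff]
    rw [← ih]
    congr 1
    funext y
    rw [add_right_comm]

theorem iteratedDiff_cons {X F : Type*} [AddCommGroup X] [AddCommGroup F] (h : X) (l : List X)
    (g : X → F) (x : X) :
    iteratedDiff (h :: l) g x = iteratedDiff l g x - iteratedDiff l g (x + h) := by
  rw [iteratedDiff, iteratedDiff_sub, iteratedDiff_comp_add]

/-- If `f (v + z) = c * g (x + A z)` for `z` small, the iterated differences are proportional. -/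
theorem iteratedDiff_eq_mul {E X : Type*} [NormedAddCommGroup E] [AddCommGroup X] {R : ℝ} (c : ℂ)
    (A : E →+ X) (l : List E) (hl : ∀ y ∈ l, ‖y‖ ≤ R) (f : E → ℂ) (g : X → ℂ) (v : E) (x : X)
    (h : ∀ z, ‖z‖ ≤ l.length * R → f (v + z) = c * g (x + A z)) :
    iteratedDiff l f v = c * iteratedDiff (l.map A) g x := by
  induction l generalizing f g with
  | nil => simpa [iteratedDiff] using h 0 (by simp)
  | cons y l ih =>
    have hy := hl y (by simp)
    have hR : 0 ≤ R := (norm_nonneg y).trans hy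
    simp only [iteratedDiff, List.map_cons]
    refine ih (fun z hz => hl z (by simp [hz])) _ _ fun z hz => ?_
    simp only [List.length_cons, Nat.cast_add, Nat.cast_one] at h
    rw [mul_sub, h z (hz.trans (by linarith)), add_assoc v, h (z + y), map_add, add_assoc]
    exact (norm_add_le _ _).trans (by linarith)

universe u

variable {X F : Type u} [NormedAddCommGroup X] [NormedSpace ℝ X] [NormedAddCommGroup F]
  [NormedSpace ℝ F]

theorem hasFDerivAt_iteratedDiff (l : List X) (g : X → F) (g' : X → X →L[ℝ] F) (x : X)
    (h : ∀ y, dist y x ≤ (l.map norm).sum → HasFDerivAt g (g' y) y) :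
    HasFDerivAt (iteratedDiff l g) (iteratedDiff l g' x) x := by
  induction l generalizing g g' with
  | nil => exact h x (by simp)
  | cons k l ih =>
    simp only [iteratedDiff]
    simp only [List.map_cons, List.sum_cons] at h
    have h0 := norm_nonneg k
    refine ih _ _ fun y hy => (h y (by linarith)).sub ?_
    rw [hasFDerivAt_comp_add_right]
    refine h _ ?_
    have := dist_triangle (y + k) y x
    rw [dist_self_add_left] at this
    linarith

/-- Induction on the number of steps: the mean value inequality handles one step, and the derivative
of the remaining difference is the same difference of `fderiv ℝ g`. The target space changes in the
induction, whence the common universe of `X` and `F`. -/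
theorem exists_norm_iteratedDiff_le (N : ℕ) {X F : Type u} [NormedAddCommGroup X]
    [NormedSpace ℝ X] [NormedAddCommGroup F] [NormedSpace ℝ F] (g : X → F) (x₀ : X)
    (hg : ContDiffAt ℝ ∞ g x₀) :
    ∃ ε > 0, ∃ C, 0 ≤ C ∧ ∀ x ∈ Metric.ball x₀ ε, ∀ l : List X, l.length = N →
      (∀ h ∈ l, ‖h‖ < ε) → ‖iteratedDiff l g x‖ ≤ C * (l.map norm).prod := by
  induction N generalizing F with
  | zero =>
    have h1 : ∀ᶠ x in 𝓝 x₀, ‖g x‖ < ‖g x₀‖ + 1 :=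
      hg.continuousAt.norm.eventually_lt_const (by linarith)
    obtain ⟨ε, hε, h2⟩ := Metric.eventually_nhds_iff_ball.1 h1
    refine ⟨ε, hε, ‖g x₀‖ + 1, by positivity, fun x hx l hl _ => ?_⟩
    rw [List.length_eq_zero_iff.1 hl]
    simpa [iteratedDiff] using (h2 x hx).le
  | succ N ih =>
    obtain ⟨ε₁, hε₁, C, hC, hbound⟩ := ih (fderiv ℝ g) (hg.fderiv_right (by simp))
    have h1 : ∀ᶠ x in 𝓝 x₀, DifferentiableAt ℝ g x := by
      have : ContDiffAt ℝ 1 g x₀ := hg.of_le (by simp)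
      exact (this.eventually (by simp)).mono fun t ht => ht.differentiableAt (by simp)
    obtain ⟨ε₂, hε₂, hdiff⟩ := Metric.eventually_nhds_iff_ball.1 h1
    -- Points of the segment from `x` to `x + h` lie within `2ε` of `x₀`, and the other `N` steps
    -- move them by at most `Nε` more.
    set ε := min (ε₁ / 2) (ε₂ / (N + 2)) with hε
    have hεpos : 0 < ε := by positivity
    have hle1 : 2 * ε ≤ ε₁ := by
      have := min_le_left (ε₁ / 2) (ε₂ / (N + 2))
      linarith
    have hle2 : (N + 2) * ε ≤ ε₂ := by
      have := min_le_right (ε₁ / 2) (ε₂ / (N + 2))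
      rw [← hε, le_div_iff₀ (by positivity)] at this
      linarith
    refine ⟨ε, hεpos, C, hC, fun x hx l hl hlε => ?_⟩
    obtain ⟨h, l, rfl⟩ : ∃ h l', l = h :: l' := by
      cases l with
      | nil => simp at hl
      | cons h l' => exact ⟨h, l', rfl⟩
    have hlN : l.length = N := by simpa using hl
    have hh : ‖h‖ < ε := hlε h (by simp)
    have hlε' : ∀ k ∈ l, ‖k‖ < ε := fun k hk => hlε k (by simp [hk])
    have hsum : (l.map norm).sum ≤ N * ε := by
      have := List.sum_le_card_nsmul (l.map norm) ε (by
        intro r hr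
        obtain ⟨k, hk, rfl⟩ := List.mem_map.1 hr
        exact (hlε' k hk).le)
      simpa [hlN] using this
    have hd : ∀ z ∈ Metric.ball x₀ (2 * ε),
        HasFDerivAt (iteratedDiff l g) (iteratedDiff l (fderiv ℝ g) z) z := by
      intro z hz
      refine hasFDerivAt_iteratedDiff l g _ z fun y hy => (hdiff y ?_).hasFDerivAt
      rw [Metric.mem_ball] at hz ⊢
      have := dist_triangle y z x₀
      linarith
    have hx2 : x ∈ Metric.ball x₀ (2 * ε) := Metric.ball_subset_ball (by linarith) hx
    have hxh : x + h ∈ Metric.ball x₀ (2 * ε) := by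
      rw [Metric.mem_ball] at hx ⊢
      have := dist_triangle (x + h) x x₀
      rw [dist_self_add_left] at this
      linarith
    have hmv := (convex_ball x₀ (2 * ε)).norm_image_sub_le_of_norm_hasFDerivWithin_le
      (fun z hz => (hd z hz).hasFDerivWithinAt)
      (fun z hz => hbound z (Metric.ball_subset_ball hle1 hz) l hlN
        fun k hk => (hlε' k hk).trans_le (by linarith)) hx2 hxh
    rw [iteratedDiff_cons, norm_sub_rev]
    refine hmv.trans (le_of_eq ?_)
    simp only [List.map_cons, List.prod_cons, add_sub_cancel_left]
    ring

end IteratedDiff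

/-! ## Averages of translates -/

section TranslationDefect

variable {E : Type*} [NormedAddCommGroup E] [MeasurableSpace E]

/-- The difference between `f` and its average over translates, distributed according to `ν`. -/
def translationDefect (ν : Measure E) (f : E → ℂ) (v : E) : ℂ := f v - ∫ y, f (v + y) ∂ν

theorem translationDefect_comp_add (ν : Measure E) (f : E → ℂ) (h : E) :
    translationDefect ν (fun v => f (v + h)) = fun v => translationDefect ν f (v + h) := by
  funext v
  simp only [translationDefect, add_right_comm]

theorem iterate_translationDefect_comp_add (ν : Measure E) (f : E → ℂ) (h : E) (N : ℕ) :
    (translationDefect ν)^[N] (fun v => f (v + h)) =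
      fun v => (translationDefect ν)^[N] f (v + h) := by
  induction N generalizing f with
  | zero => rfl
  | succ N ih => simp only [Function.iterate_succ_apply, translationDefect_comp_add, ih]

/-- Peetre's inequality: `1 + ‖v‖ ≤ (1 + R)(1 + ‖v + y‖)` when `‖y‖ ≤ R`. -/
theorem norm_integral_add_le {ν : Measure E} {R : ℝ} [IsProbabilityMeasure ν]
    (hν : ∀ᵐ y ∂ν, ‖y‖ ≤ R) {f : E → ℂ} {C σ : ℝ} (hσ : 0 ≤ σ)
    (hC : 0 ≤ C) (hf : ∀ v, ‖f v‖ ≤ C * (1 + ‖v‖) ^ (-σ)) (v : E) :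
    ‖∫ y, f (v + y) ∂ν‖ ≤ C * (1 + R) ^ σ * (1 + ‖v‖) ^ (-σ) := by
  refine (norm_integral_le_of_norm_le_const (C := C * (1 + R) ^ σ * (1 + ‖v‖) ^ (-σ)) ?_).trans
    (by simp)
  filter_upwards [hν] with y hy
  have hR : 0 ≤ R := (norm_nonneg y).trans hy
  refine (hf _).trans ?_
  rw [mul_assoc]
  refine mul_le_mul_of_nonneg_left ?_ hC
  have h1 : 1 + ‖v‖ ≤ (1 + R) * (1 + ‖v + y‖) := by
    have h2 := norm_sub_le (v + y) y
    rw [add_sub_cancel_right] at h2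
    nlinarith [norm_nonneg (v + y), mul_nonneg hR (norm_nonneg (v + y))]
  rw [Real.rpow_neg (by positivity), Real.rpow_neg (by positivity), inv_le_iff_one_le_mul₀
    (by positivity)]
  have h3 := Real.rpow_le_rpow (by positivity) h1 hσ
  rw [Real.mul_rpow (by positivity) (by positivity)] at h3
  rw [mul_right_comm, ← div_eq_mul_inv, one_le_div (by positivity)]
  exact h3

theorem exists_iterate_translationDefect_decay {ν : Measure E} {R : ℝ}
    [IsProbabilityMeasure ν] (hν : ∀ᵐ y ∂ν, ‖y‖ ≤ R) {f : E → ℂ} {σ : ℝ}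
    (hσ : 0 ≤ σ) (hR : 0 ≤ R) (hf : ∃ C, 0 ≤ C ∧ ∀ v, ‖f v‖ ≤ C * (1 + ‖v‖) ^ (-σ)) (N : ℕ) :
    ∃ C, 0 ≤ C ∧ ∀ v, ‖(translationDefect ν)^[N] f v‖ ≤ C * (1 + ‖v‖) ^ (-σ) := by
  induction N generalizing f with
  | zero => exact hf
  | succ N ih =>
    obtain ⟨C, hC, hf⟩ := hf
    refine ih ⟨C + C * (1 + R) ^ σ, by positivity, fun v => ?_⟩
    rw [add_mul]
    exact (norm_sub_le _ _).trans (add_le_add (hf v) (norm_integral_add_le hν hσ hC hf v))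

variable [BorelSpace E] [ProperSpace E] {ν : Measure E} [IsProbabilityMeasure ν] {R : ℝ}

theorem integrable_of_continuous (hν : ∀ᵐ y ∂ν, ‖y‖ ≤ R) {f : E → ℂ} (hf : Continuous f) :
    Integrable f ν := by
  have h : ν.restrict (Metric.closedBall 0 R) = ν :=
    Measure.restrict_eq_self_of_ae_mem (by simpa using hν)
  rw [← h]
  exact hf.continuousOn.integrableOn_compact (isCompact_closedBall 0 R)

theorem continuous_translationDefect {X : Type*} [TopologicalSpace X] [FirstCountableTopology X]
    [LocallyCompactSpace X] (hν : ∀ᵐ y ∂ν, ‖y‖ ≤ R) {f : X → E → ℂ}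
    (hf : Continuous (Function.uncurry f)) :
    Continuous (Function.uncurry fun x => translationDefect ν (f x)) := by
  have h : ν.restrict (Metric.closedBall 0 R) = ν :=
    Measure.restrict_eq_self_of_ae_mem (by simpa using hν)
  have h1 : Continuous fun q : X × E => ∫ y in Metric.closedBall 0 R, f q.1 (q.2 + y) ∂ν :=
    continuous_parametric_integral_of_continuous (f := fun (q : X × E) y => f q.1 (q.2 + y))
      (hf.comp (g := Function.uncurry f) (f := fun q : (X × E) × E => (q.1.1, q.1.2 + q.2))
        (by fun_prop)) (isCompact_closedBall 0 R)
  rw [h] at h1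
  exact hf.sub h1

theorem continuous_iterate_translationDefect {X : Type*} [TopologicalSpace X]
    [FirstCountableTopology X] [LocallyCompactSpace X] (hν : ∀ᵐ y ∂ν, ‖y‖ ≤ R) {f : X → E → ℂ}
    (hf : Continuous (Function.uncurry f)) (N : ℕ) :
    Continuous (Function.uncurry fun x => (translationDefect ν)^[N] (f x)) := by
  induction N generalizing f with
  | zero => exact hf
  | succ N ih => exact ih (continuous_translationDefect hν hf)

theorem continuous_iterate_translationDefect' (hν : ∀ᵐ y ∂ν, ‖y‖ ≤ R) {f : E → ℂ}
    (hf : Continuous f) (N : ℕ) : Continuous ((translationDefect ν)^[N] f) :=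
  (continuous_iterate_translationDefect (X := Unit) (f := fun _ => f) hν
    (hf.comp continuous_snd) N).comp (f := fun v => ((), v)) (by fun_prop)

theorem iterate_translationDefect_sub (hν : ∀ᵐ y ∂ν, ‖y‖ ≤ R) {f g : E → ℂ} (hf : Continuous f)
    (hg : Continuous g) (N : ℕ) : (translationDefect ν)^[N] (fun v => f v - g v) =
      fun v => (translationDefect ν)^[N] f v - (translationDefect ν)^[N] g v := by
  induction N generalizing f g with
  | zero => rfl
  | succ N ih =>
    have h : translationDefect ν (fun v => f v - g v) =
        fun v => translationDefect ν f v - translationDefect ν g v := by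
      funext v
      simp only [translationDefect]
      rw [integral_sub (integrable_of_continuous hν (by fun_prop))
        (integrable_of_continuous hν (by fun_prop))]
      ring
    simp only [Function.iterate_succ_apply, h]
    exact ih (continuous_iterate_translationDefect' hν hf 1)
      (continuous_iterate_translationDefect' hν hg 1)

/-- Since `ν` has mass one, the defect is the average over `y` of `f v - f (v + y)`. Iterating, the
`N`-fold defect is an average of `N`-fold differences with steps bounded by `R`. -/
theorem norm_iterate_translationDefect_le (hν : ∀ᵐ y ∂ν, ‖y‖ ≤ R) {N : ℕ} {f : E → ℂ}
    (hf : Continuous f) {v : E} {C : ℝ}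
    (h : ∀ l : List E, l.length = N → (∀ y ∈ l, ‖y‖ ≤ R) → ‖iteratedDiff l f v‖ ≤ C) :
    ‖(translationDefect ν)^[N] f v‖ ≤ C := by
  induction N generalizing f with
  | zero => simpa [iteratedDiff] using h [] rfl (by simp)
  | succ N ih =>
    have hc := continuous_iterate_translationDefect' hν hf N
    have h1 : (translationDefect ν)^[N + 1] f v =
        ∫ y, (translationDefect ν)^[N] (fun w => f w - f (w + y)) v ∂ν := by
      have h2 : ∀ y, (translationDefect ν)^[N] (fun w => f w - f (w + y)) v =
          (translationDefect ν)^[N] f v - (translationDefect ν)^[N] f (v + y) := by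
        intro y
        rw [iterate_translationDefect_sub hν hf (by fun_prop),
          iterate_translationDefect_comp_add]
      simp only [h2]
      rw [integral_sub (integrable_const _) (integrable_of_continuous hν (by fun_prop)),
        integral_const, Function.iterate_succ_apply', translationDefect]
      simp
    rw [h1]
    refine (norm_integral_le_of_norm_le_const (C := C) ?_).trans (by simp)
    filter_upwards [hν] with y hy
    refine ih (by fun_prop) fun l hl hlR => ?_
    refine h (y :: l) (by simp [hl]) ?_
    simpa using ⟨hy, hlR⟩

theorem hasDerivAt_translationDefect (hν : ∀ᵐ y ∂ν, ‖y‖ ≤ R) {f f' : ℂ → E → ℂ}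
    (hf : Continuous (Function.uncurry f)) (hf' : Continuous (Function.uncurry f'))
    (hd : ∀ s v, HasDerivAt (fun s => f s v) (f' s v) s) (s : ℂ) (v : E) :
    HasDerivAt (fun s => translationDefect ν (f s) v) (translationDefect ν (f' s) v) s := by
  refine (hd s v).sub ?_
  obtain ⟨C, hC⟩ := ((isCompact_closedBall s 1).prod
    (isCompact_closedBall v R)).exists_bound_of_continuousOn hf'.continuousOn
  have hs : ∀ (g : ℂ → E → ℂ), Continuous (Function.uncurry g) → ∀ s,
      Continuous fun y => g s (v + y) := fun g hg s =>
    hg.comp (g := Function.uncurry g) (f := fun y => (s, v + y)) (by fun_prop)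
  refine (hasDerivAt_integral_of_dominated_loc_of_deriv_le (bound := fun _ => C)
    (F := fun s y => f s (v + y)) (F' := fun s y => f' s (v + y))
    (Metric.closedBall_mem_nhds s one_pos) ?_ ?_ ?_ ?_ (integrable_const C) ?_).2
  · exact Eventually.of_forall fun s =>
      (integrable_of_continuous hν (hs f hf s)).aestronglyMeasurable
  · exact integrable_of_continuous hν (hs f hf s)
  · exact (integrable_of_continuous hν (hs f' hf' s)).aestronglyMeasurable
  · filter_upwards [hν] with y hy z hz
    exact hC (z, v + y) ⟨hz, by simpa using hy⟩
  · exact Eventually.of_forall fun y z _ => hd z (v + y)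

theorem hasDerivAt_iterate_translationDefect (hν : ∀ᵐ y ∂ν, ‖y‖ ≤ R) {f f' : ℂ → E → ℂ}
    (hf : Continuous (Function.uncurry f)) (hf' : Continuous (Function.uncurry f'))
    (hd : ∀ s v, HasDerivAt (fun s => f s v) (f' s v) s) (N : ℕ) (s : ℂ) (v : E) :
    HasDerivAt (fun s => (translationDefect ν)^[N] (f s) v)
      ((translationDefect ν)^[N] (f' s) v) s := by
  induction N generalizing f f' with
  | zero => exact hd s v
  | succ N ih =>
    exact ih (continuous_translationDefect hν hf) (continuous_translationDefect hν hf')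
      (hasDerivAt_translationDefect hν hf hf' hd)

end TranslationDefect

/-! ## Sums over lattices -/

section CellMeasure

variable {E : Type*} [NormedAddCommGroup E] [NormedSpace ℝ E] [MeasurableSpace E] {ι : Type*}
  [Fintype ι]

/-- The normalized restriction of `μ` to the fundamental cell of a basis. -/
def cellMeasure (b : Module.Basis ι ℝ E) (μ : Measure E) : Measure E :=
  ProbabilityTheory.cond μ (ZSpan.fundamentalDomain b)

theorem exists_ae_cellMeasure_norm_le [OpensMeasurableSpace E] (b : Module.Basis ι ℝ E)
    (μ : Measure E) : ∃ R, 0 ≤ R ∧ ∀ᵐ y ∂(cellMeasure b μ), ‖y‖ ≤ R := by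
  obtain ⟨R, hR⟩ := (ZSpan.fundamentalDomain_isBounded b).exists_norm_le
  refine ⟨|R|, abs_nonneg R, ?_⟩
  filter_upwards [ProbabilityTheory.ae_cond_mem (ZSpan.fundamentalDomain_measurableSet b)] with y hy
  exact (hR y hy).trans (le_abs_self R)

end CellMeasure

/-! ### Comparison of lattice sums with integrals -/

section LatticeSum

variable {E : Type*} [NormedAddCommGroup E] [NormedSpace ℝ E] [FiniteDimensional ℝ E]

theorem summable_of_decay (L : Submodule ℤ E) [DiscreteTopology L] [IsZLattice ℝ L] {F : Type*}
    [NormedAddCommGroup F] [CompleteSpace F] {f : L → F} {C σ : ℝ} (hσ : Module.finrank ℝ E < σ)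
    (hf : ∀ᶠ v : L in cofinite, ‖f v‖ ≤ C * ‖v‖ ^ (-σ)) : Summable f := by
  refine Summable.of_norm_bounded_eventually (g := fun v : L => C * ‖v‖ ^ (-σ))
    ((ZLattice.summable_norm_rpow L (-σ) ?_).mul_left C) hf
  rw [ZLattice.rank ℝ L]
  linarith

theorem summable_of_decay_one_add (L : Submodule ℤ E) [DiscreteTopology L] [IsZLattice ℝ L]
    {f : E → ℂ} {σ : ℝ} (hσ : Module.finrank ℝ E < σ)
    (hf : ∃ C, 0 ≤ C ∧ ∀ v, ‖f v‖ ≤ C * (1 + ‖v‖) ^ (-σ)) : Summable fun v : L => f v := by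
  obtain ⟨C, hC, hf⟩ := hf
  refine summable_of_decay L (C := C) hσ ?_
  have h0 : ∀ᶠ v : L in cofinite, v ≠ 0 := by
    rw [eventually_cofinite]
    exact (Set.finite_singleton (0 : L)).subset (by simp)
  filter_upwards [h0] with v hv
  refine (hf v).trans (mul_le_mul_of_nonneg_left ?_ hC)
  have : 0 < ‖(v : E)‖ := norm_pos_iff.2 (by simpa using hv)
  refine Real.rpow_le_rpow_of_nonpos this (by rw [Submodule.coe_norm]; linarith) ?_
  have : (0 : ℝ) ≤ Module.finrank ℝ E := by positivity
  linarith


variable [MeasurableSpace E] [BorelSpace E]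

theorem integrable_of_decay (μ : Measure E) [μ.IsAddHaarMeasure] {f : E → ℂ} (hc : Continuous f)
    {σ : ℝ} (hσ : Module.finrank ℝ E < σ)
    (hf : ∃ C, 0 ≤ C ∧ ∀ v, ‖f v‖ ≤ C * (1 + ‖v‖) ^ (-σ)) : Integrable f μ := by
  obtain ⟨C, hC, hf⟩ := hf
  exact ((integrable_one_add_norm hσ).const_mul C).mono' hc.aestronglyMeasurable
    (Eventually.of_forall hf)

/-- By Fubini and translation invariance, averaging over translates preserves the integral. -/
theorem integral_translationDefect (μ : Measure E) [μ.IsAddHaarMeasure] (ν : Measure E)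
    [IsProbabilityMeasure ν] {f : E → ℂ} (hc : Continuous f) (hf : Integrable f μ) :
    ∫ v, translationDefect ν f v ∂μ = 0 := by
  have hint : Integrable (Function.uncurry fun (v y : E) => f (v + y)) (μ.prod ν) := by
    have hm : AEStronglyMeasurable (Function.uncurry fun (v y : E) => f (v + y)) (μ.prod ν) :=
      (hc.comp (f := fun q : E × E => q.1 + q.2) (by fun_prop)).aestronglyMeasurable
    rw [integrable_prod_iff' hm]
    refine ⟨Eventually.of_forall fun y => hf.comp_add_right y, ?_⟩
    simp only [Function.uncurry_apply_pair]
    have : ∀ y, ∫ x, ‖f (x + y)‖ ∂μ = ∫ x, ‖f x‖ ∂μ := fun y =>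
      integral_add_right_eq_self (fun x => ‖f x‖) y
    simp only [this]
    exact integrable_const _
  simp only [translationDefect]
  have h1 : Integrable (fun v => ∫ y, f (v + y) ∂ν) μ := hint.integral_prod_left
  rw [integral_sub hf h1, integral_integral_swap hint]
  have : ∀ y, ∫ x, f (x + y) ∂μ = ∫ x, f x ∂μ := fun y => integral_add_right_eq_self f y
  simp [this]

variable {ι : Type*} [Fintype ι]

variable (b : Module.Basis ι ℝ E) (μ : Measure E) [μ.IsAddHaarMeasure]

instance : IsProbabilityMeasure (cellMeasure b μ) :=
  ProbabilityTheory.cond_isProbabilityMeasure_of_finite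
    (ZSpan.measure_fundamentalDomain_ne_zero b) (ZSpan.fundamentalDomain_isBounded b).measure_lt_top.ne

/-- The lattice translates of the fundamental cell tile the space. -/
theorem tsum_integral_cellMeasure {f : E → ℂ} (hf : Integrable f μ) :
    ∑' v : Submodule.span ℤ (Set.range b), ∫ y, f (v + y) ∂(cellMeasure b μ) =
      ((μ.real (ZSpan.fundamentalDomain b))⁻¹ : ℝ) • ∫ v, f v ∂μ := by
  have hdom := ZSpan.isAddFundamentalDomain' b μ
  have : Countable (Submodule.span ℤ (Set.range b)).toAddSubgroup :=
    inferInstanceAs (Countable (Submodule.span ℤ (Set.range b)))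
  have : ∀ v : E, ∫ y, f (v + y) ∂(cellMeasure b μ) = ((μ.real (ZSpan.fundamentalDomain b))⁻¹ : ℝ) •
      ∫ y in ZSpan.fundamentalDomain b, f (v + y) ∂μ := by
    intro v
    rw [cellMeasure, ProbabilityTheory.cond, integral_smul_measure, ENNReal.toReal_inv]
    rfl
  simp only [this]
  rw [tsum_const_smul'', hdom.integral_eq_tsum'' f hf]
  rfl

theorem tsum_translationDefect {f : E → ℂ} (hc : Continuous f) {σ : ℝ}
    (hσ : Module.finrank ℝ E < σ) (hf : ∃ C, 0 ≤ C ∧ ∀ v, ‖f v‖ ≤ C * (1 + ‖v‖) ^ (-σ)) :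
    ∑' v : Submodule.span ℤ (Set.range b), translationDefect (cellMeasure b μ) f v =
      ∑' v : Submodule.span ℤ (Set.range b), f v -
        ((μ.real (ZSpan.fundamentalDomain b))⁻¹ : ℝ) • ∫ v, f v ∂μ := by
  obtain ⟨R, hR, hν⟩ := exists_ae_cellMeasure_norm_le b μ
  have hσ0 : 0 ≤ σ := by
    have : (0 : ℝ) ≤ Module.finrank ℝ E := by positivity
    linarith
  rw [← tsum_integral_cellMeasure b μ (integrable_of_decay μ hc hσ hf), ← Summable.tsum_sub]
  · rfl
  · exact summable_of_decay_one_add _ hσ hf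
  · obtain ⟨C, hC, hf⟩ := hf
    exact summable_of_decay_one_add _ (f := fun v => ∫ y, f (v + y) ∂(cellMeasure b μ)) hσ
      ⟨_, by positivity, norm_integral_add_le hν hσ0 hC hf⟩

/-- The sum over the lattice minus the normalized integral is the sum of the iterated translation
defects. -/
theorem tsum_eq_integral_add_tsum_iterate {f : E → ℂ} (hc : Continuous f) {σ : ℝ}
    (hσ : Module.finrank ℝ E < σ) (hf : ∃ C, 0 ≤ C ∧ ∀ v, ‖f v‖ ≤ C * (1 + ‖v‖) ^ (-σ)) (N : ℕ) :
    ∑' v : Submodule.span ℤ (Set.range b), f v =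
      ((μ.real (ZSpan.fundamentalDomain b))⁻¹ : ℝ) • ∫ v, f v ∂μ +
      ∑' v : Submodule.span ℤ (Set.range b), (translationDefect (cellMeasure b μ))^[N + 1] f v := by
  obtain ⟨R, hR, hν⟩ := exists_ae_cellMeasure_norm_le b μ
  have hσ0 : 0 ≤ σ := by
    have : (0 : ℝ) ≤ Module.finrank ℝ E := by positivity
    linarith
  induction N with
  | zero =>
    simp only [zero_add, Function.iterate_one]
    rw [tsum_translationDefect b μ hc hσ hf]
    ring
  | succ N ih =>
    rw [ih]
    congr 1
    have hcN := fun N => continuous_iterate_translationDefect' hν hc N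
    have hfN := fun N => exists_iterate_translationDefect_decay hν hσ0 hR hf N
    have h := tsum_translationDefect b μ (hcN (N + 1)) hσ (hfN (N + 1))
    rw [Function.iterate_succ_apply' _ (N + 1), h]
    -- Only the first defect contributes an integral: the function to which each later defect is
    -- applied is already a defect, with integral zero.
    rw [Function.iterate_succ_apply' _ N, integral_translationDefect μ _ (hcN N)
      (integrable_of_decay μ (hcN N) hσ (hfN N)), smul_zero, sub_zero]

end LatticeSum

/-! ## Powers of the distance to a convex body -/

section DistPow

variable {E : Type*} [NormedAddCommGroup E]

/-- The function `max (dist (v, K)) T₀ ^ (-s)`. -/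
def distPow (K : Set E) (T₀ : ℝ) (s : ℂ) (v : E) : ℂ :=
  Complex.exp (-s * (Real.log (max (Metric.infDist v K) T₀) : ℝ))

theorem exp_neg_mul_log {x : ℝ} (hx : 0 < x) (s : ℂ) :
    Complex.exp (-s * (Real.log x : ℝ)) = (x : ℂ) ^ (-s) := by
  rw [Complex.cpow_def_of_ne_zero (by exact_mod_cast hx.ne'), Complex.ofReal_log hx.le, mul_comm]

theorem distPow_eq (K : Set E) {T₀ : ℝ} (hT : 0 < T₀) (s : ℂ) (v : E) :
    distPow K T₀ s v = ((max (Metric.infDist v K) T₀ : ℝ) : ℂ) ^ (-s) :=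
  exp_neg_mul_log (lt_max_of_lt_right hT) s

theorem norm_distPow (K : Set E) {T₀ : ℝ} (hT : 0 < T₀) (s : ℂ) (v : E) :
    ‖distPow K T₀ s v‖ = max (Metric.infDist v K) T₀ ^ (-s.re) := by
  rw [distPow_eq K hT, Complex.norm_cpow_eq_rpow_re_of_pos (lt_max_of_lt_right hT), Complex.neg_re]

theorem continuous_log_max_infDist (K : Set E) {T₀ : ℝ} (hT : 0 < T₀) :
    Continuous fun v : E => ((Real.log (max (Metric.infDist v K) T₀) : ℝ) : ℂ) :=
  Complex.continuous_ofReal.comp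
    (((Metric.continuous_infDist_pt K).max continuous_const).log
      fun _ => (lt_max_of_lt_right hT).ne')

theorem continuous_distPow (K : Set E) {T₀ : ℝ} (hT : 0 < T₀) :
    Continuous (Function.uncurry (distPow K T₀)) := by
  have := (continuous_log_max_infDist K hT).comp (continuous_snd (X := ℂ))
  exact Complex.continuous_exp.comp (continuous_fst.neg.mul this)

theorem continuous_distPow_right (K : Set E) {T₀ : ℝ} (hT : 0 < T₀) (s : ℂ) :
    Continuous (distPow K T₀ s) :=
  (continuous_distPow K hT).comp (f := fun v => (s, v)) (by fun_prop)

/-- The derivative of `distPow` with respect to `s`. -/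
def distPowDeriv (K : Set E) (T₀ : ℝ) (s : ℂ) (v : E) : ℂ :=
  distPow K T₀ s v * -(Real.log (max (Metric.infDist v K) T₀) : ℝ)

theorem continuous_distPowDeriv (K : Set E) {T₀ : ℝ} (hT : 0 < T₀) :
    Continuous (Function.uncurry (distPowDeriv K T₀)) := by
  have := (continuous_log_max_infDist K hT).comp (continuous_snd (X := ℂ))
  exact (continuous_distPow K hT).mul this.neg

theorem hasDerivAt_distPow (K : Set E) (T₀ : ℝ) (s : ℂ) (v : E) :
    HasDerivAt (fun s => distPow K T₀ s v) (distPowDeriv K T₀ s v) s := by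
  have h : HasDerivAt (fun s : ℂ => -s * (Real.log (max (Metric.infDist v K) T₀) : ℝ))
      (-1 * (Real.log (max (Metric.infDist v K) T₀) : ℝ)) s :=
    (hasDerivAt_neg s).mul_const _
  simpa [distPowDeriv, distPow] using h.cexp

theorem norm_le_infDist_add {K : Set E} (hn : K.Nonempty) {M : ℝ} (hM : ∀ x ∈ K, ‖x‖ ≤ M) (v : E) :
    ‖v‖ ≤ Metric.infDist v K + M := by
  rw [← sub_le_iff_le_add]
  refine (Metric.le_infDist hn).2 fun {y} hy => ?_
  have := norm_sub_norm_le v y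
  rw [dist_eq_norm]
  linarith [hM y hy]

theorem exists_distPow_decay {K : Set E} (hn : K.Nonempty) (hb : Bornology.IsBounded K) {T₀ : ℝ}
    (hT : 0 < T₀) {s : ℂ} (hs : 0 ≤ s.re) :
    ∃ C, 0 ≤ C ∧ ∀ v, ‖distPow K T₀ s v‖ ≤ C * (1 + ‖v‖) ^ (-s.re) := by
  obtain ⟨M, hM⟩ := hb.exists_norm_le
  have hM0 : 0 ≤ M := (norm_nonneg _).trans (hM _ hn.some_mem)
  set A := 1 + (1 + M) / T₀ with hA
  have hApos : 0 < A := by positivity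
  refine ⟨A ^ s.re, by positivity, fun v => ?_⟩
  rw [norm_distPow K hT]
  set m := max (Metric.infDist v K) T₀ with hm
  have hmpos : 0 < m := lt_max_of_lt_right hT
  have h1 : 1 + ‖v‖ ≤ A * m := by
    have h2 := norm_le_infDist_add hn hM v
    have h3 : Metric.infDist v K ≤ m := le_max_left _ _
    have h4 : T₀ ≤ m := le_max_right _ _
    have h5 : 1 + M ≤ (1 + M) / T₀ * m := by
      rw [div_mul_eq_mul_div, le_div_iff₀ hT]
      exact mul_le_mul_of_nonneg_left h4 (by positivity)
    rw [hA, add_mul]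
    linarith
  rw [Real.rpow_neg hmpos.le, Real.rpow_neg (by positivity), ← div_eq_mul_inv,
    le_div_iff₀ (by positivity), inv_mul_le_iff₀ (by positivity), mul_comm (m ^ s.re),
    ← Real.mul_rpow hApos.le hmpos.le]
  exact Real.rpow_le_rpow (by positivity) h1 hs

end DistPow

/-! ### Symbol estimates for powers of the distance -/

section SymbolEstimate

/-- The map `(w, t) ↦ (w + t P w, t)` is smooth near `(v₀, 0)`, also across `t = 0`, with invertible
derivative `(y, m) ↦ (y + m P v₀, m)` there. For `t > 0` it inverts the projection onto `tK`, so the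
scaled distance is the norm of the first component of its local inverse. -/
theorem IsSupportMap.exists_smooth_scaled_infDist {E : Type*} [NormedAddCommGroup E]
    [InnerProductSpace ℝ E] [FiniteDimensional ℝ E] {K : Set E} {P : E → E}
    (hP : IsSupportMap K P) (hc : IsCompact K) (hn : K.Nonempty) (hcv : Convex ℝ K) {v₀ : E}
    (hv₀ : v₀ ≠ 0) : ∃ W : E × ℝ → ℝ, ContDiffAt ℝ ∞ W (v₀, 0) ∧ 0 < W (v₀, 0) ∧
      ∀ᶠ q in 𝓝 (v₀, (0 : ℝ)), 0 < q.2 → q.2 * Metric.infDist (q.2⁻¹ • q.1) K = W q := by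
  have hPc : ContDiffAt ℝ ∞ (fun q : E × ℝ => P q.1) (v₀, 0) :=
    ContDiffAt.comp (v₀, (0 : ℝ)) (g := P) (hP.contDiffAt hv₀) contDiffAt_fst
  have hPd := (hPc.differentiableAt (by simp)).hasFDerivAt
  have hΨ : ContDiffAt ℝ ∞ (fun q : E × ℝ => (q.1 + q.2 • P q.1, q.2)) (v₀, 0) := by
    have h2 : ContDiffAt ℝ ∞ (fun q : E × ℝ => q.2) (v₀, 0) := contDiffAt_snd
    exact (contDiffAt_fst.add (h2.smul hPc)).prodMk h2
  have h1 : HasFDerivAt (fun q : E × ℝ => q.1) (ContinuousLinearMap.fst ℝ E ℝ) (v₀, 0) :=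
    hasFDerivAt_fst
  have h2 : HasFDerivAt (fun q : E × ℝ => q.2) (ContinuousLinearMap.snd ℝ E ℝ) (v₀, 0) :=
    hasFDerivAt_snd
  have hΨd := (h1.add (h2.smul hPd)).prodMk h2
  obtain ⟨L, hL, hLi⟩ := exists_smooth_leftInverse hΨ hΨd (by
    rintro ⟨y, m⟩ hym
    rw [ContinuousLinearMap.prod_apply, Prod.mk_eq_zero] at hym
    obtain ⟨h3, h4⟩ := hym
    have h4' : m = 0 := h4
    subst h4'
    have : y = 0 := by simpa using h3
    rw [this]; rfl) rfl
  have hL0 := hLi.self_of_nhds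
  simp only [zero_smul, add_zero] at hL hL0
  refine ⟨fun q => ‖(L q).1‖, ?_, ?_, ?_⟩
  · exact ContDiffAt.norm ℝ (contDiffAt_fst.comp _ hL) (by rw [hL0]; exact hv₀)
  · simpa [hL0] using hv₀
  obtain ⟨M, hM⟩ := hc.isBounded.exists_norm_le
  obtain ⟨ε, hε, hball⟩ := Metric.eventually_nhds_iff_ball.1 hLi
  have e1 : ∀ᶠ q : E × ℝ in 𝓝 (v₀, 0), ‖q.1 - v₀‖ + q.2 * M < ε := by
    have : Tendsto (fun q : E × ℝ => ‖q.1 - v₀‖ + q.2 * M) (𝓝 (v₀, 0))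
        (𝓝 (‖v₀ - v₀‖ + 0 * M)) := by
      apply Continuous.tendsto (f := fun q : E × ℝ => ‖q.1 - v₀‖ + q.2 * M)
      fun_prop
    exact this.eventually_lt_const (by simpa using hε)
  have e2 : ∀ᶠ q : E × ℝ in 𝓝 (v₀, 0), 0 < ‖q.1‖ - q.2 * M := by
    have : Tendsto (fun q : E × ℝ => ‖q.1‖ - q.2 * M) (𝓝 (v₀, 0))
        (𝓝 (‖v₀‖ - 0 * M)) := by
      apply Continuous.tendsto (f := fun q : E × ℝ => ‖q.1‖ - q.2 * M)
      fun_prop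
    exact this.eventually_const_lt (by simpa using hv₀)
  have e3 : ∀ᶠ q : E × ℝ in 𝓝 (v₀, 0), q.2 < ε :=
    (continuous_snd.tendsto (v₀, (0 : ℝ))).eventually_lt_const hε
  filter_upwards [e1, e2, e3] with ⟨v, t⟩ h1 h2 h3 ht
  simp only at h1 h2 h3 ht ⊢
  have hvK : t⁻¹ • v ∉ K := by
    intro hK
    have := hM _ hK
    rw [norm_smul, norm_inv, Real.norm_of_nonneg ht.le, inv_mul_le_iff₀ ht] at this
    linarith
  obtain ⟨w, hw, hwv⟩ := hP.exists_add_eq hc hn hcv hvK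
  have hΨw : (t • w + t • P (t • w), t) = (v, t) := by
    rw [hP.smul hw ht, ← smul_add, hwv, smul_inv_smul₀ ht.ne']
  -- `L` is a left inverse only near `(v₀, 0)`; the preimage lies there because `‖t w - v₀‖ ≤ ‖v -
  -- v₀‖ + t M`.
  have hLw : L (v, t) = (t • w, t) := by
    have hmem : (t • w, t) ∈ Metric.ball (v₀, (0 : ℝ)) ε := by
      rw [Metric.mem_ball, Prod.dist_eq, max_lt_iff]
      refine ⟨?_, by simpa [abs_of_pos ht] using h3⟩
      have h4 : t • w - v₀ = (v - v₀) - t • P w := by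
        rw [← smul_inv_smul₀ ht.ne' v, ← hwv, smul_add]; abel
      rw [dist_eq_norm, h4]
      refine (norm_sub_le _ _).trans_lt (lt_of_le_of_lt ?_ h1)
      rw [norm_smul, Real.norm_of_nonneg ht.le]
      gcongr
      exact hM _ (hP.mem hw)
    have := hball _ hmem
    rwa [hΨw] at this
  rw [hLw, ← hwv, hP.infDist hw, norm_smul, Real.norm_of_nonneg ht.le]

variable {E : Type} [NormedAddCommGroup E] [InnerProductSpace ℝ E] [FiniteDimensional ℝ E]

theorem prod_map_norm_le {X : Type*} [NormedAddCommGroup X] {c : ℝ} (l : List X)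
    (h : ∀ x ∈ l, ‖x‖ ≤ c) : (l.map norm).prod ≤ c ^ l.length := by
  induction l with
  | nil => simp
  | cons x l ih =>
    have hx := h x (by simp)
    simp only [List.map_cons, List.prod_cons, List.length_cons, pow_succ']
    exact mul_le_mul hx (ih fun y hy => h y (by simp [hy]))
      (List.prod_nonneg (by simp +contextual)) ((norm_nonneg x).trans hx)

/-- Scaling by `r` gives `f_s (r u + z) = r^(-s) G(u + z/r, 1/r, s)` with `G` smooth near `(u₀, 0,
s₀)`. The steps shrink to size at most `R/r`, so `N` differences gain `r^(-N)`. Keeping `s` among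
the variables of `G` makes the bound uniform near `s₀`. -/
theorem IsSupportMap.exists_norm_iteratedDiff_distPow_le_near {K : Set E} {P : E → E}
    (hP : IsSupportMap K P) (hc : IsCompact K) (hn : K.Nonempty) (hcv : Convex ℝ K) {T₀ : ℝ}
    (hT : 0 < T₀) (s₀ : ℂ) (N : ℕ) {R : ℝ} (hR : 0 ≤ R) {u₀ : E} (hu₀ : ‖u₀‖ = 1) :
    ∃ η > 0, ∃ r₀ > 0, ∃ C, 0 ≤ C ∧ ∀ u ∈ Metric.sphere (0 : E) 1 ∩ Metric.ball u₀ η,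
      ∀ s ∈ Metric.ball s₀ η, ∀ r ≥ r₀, ∀ l : List E, l.length = N → (∀ y ∈ l, ‖y‖ ≤ R) →
        ‖iteratedDiff l (distPow K T₀ s) (r • u)‖ ≤ C * r ^ (-s.re - N) := by
  have hu₀0 : u₀ ≠ 0 := by
    rintro rfl
    simp at hu₀
  obtain ⟨W, hW, hWpos, hWeq⟩ := hP.exists_smooth_scaled_infDist hc hn hcv hu₀0
  obtain ⟨M, hM⟩ := hc.isBounded.exists_norm_le
  have hM0 : 0 ≤ M := (norm_nonneg _).trans (hM _ hn.some_mem)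
  set G : E × ℝ × ℂ → ℂ := fun q => Complex.exp (-q.2.2 * (Real.log (W (q.1, q.2.1)) : ℝ)) with hG
  have hGc : ContDiffAt ℝ ∞ G (u₀, 0, s₀) := by
    have h1 : ContDiffAt ℝ ∞ (fun q : E × ℝ × ℂ => W (q.1, q.2.1)) (u₀, 0, s₀) :=
      ContDiffAt.comp (u₀, (0 : ℝ), s₀) (g := W) hW (by fun_prop)
    have h2 := h1.log hWpos.ne'
    have h3 : ContDiffAt ℝ ∞ (fun q : E × ℝ × ℂ => ((Real.log (W (q.1, q.2.1)) : ℝ) : ℂ))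
        (u₀, 0, s₀) := Complex.ofRealCLM.contDiff.contDiffAt.comp _ h2
    have h4 : ContDiffAt ℝ ∞ (fun q : E × ℝ × ℂ => -q.2.2) (u₀, 0, s₀) := by fun_prop
    exact (h4.mul h3).cexp
  obtain ⟨ε₁, hε₁, C, hC, hbound⟩ := exists_norm_iteratedDiff_le N G _ hGc
  obtain ⟨ε₂, hε₂, hball⟩ := Metric.eventually_nhds_iff_ball.1 hWeq
  set η := min ε₁ (ε₂ / 2) with hη
  have hηpos : 0 < η := by positivity
  have hη1 : η ≤ ε₁ := min_le_left _ _
  have hη2 : η ≤ ε₂ / 2 := min_le_right _ _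
  -- The first bound keeps all translates at distance at least `T₀` from `K`, so the truncation is
  -- inactive. The second makes `NR/r`, `R/r` and `1/r` together smaller than `η`.
  set r₀ := max (max 1 (N * R + M + T₀)) (((N + 1) * R + 1) / η + 1) with hr₀
  refine ⟨η, hηpos, r₀, lt_max_of_lt_left (lt_max_of_lt_left one_pos), C * R ^ N, by positivity,
    fun u hu s hs r hr l hl hlR => ?_⟩
  have hr1 : 1 ≤ r := ((le_max_left _ _).trans (le_max_left _ _)).trans hr
  have hr2 : N * R + M + T₀ ≤ r := ((le_max_right _ _).trans (le_max_left _ _)).trans hr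
  have hr3 : ((N + 1) * R + 1) / η < r := 
    (lt_add_one _).trans_le ((le_max_right _ _).trans hr)
  have hr0 : 0 < r := by linarith
  have hsmall : r⁻¹ * ((N + 1) * R + 1) < η := by
    rw [div_lt_iff₀ hηpos] at hr3
    rwa [inv_mul_lt_iff₀ hr0]
  have hrinv : 0 < r⁻¹ := inv_pos.2 hr0
  have hNR : 0 ≤ r⁻¹ * (N * R) := by positivity
  have hRr : 0 ≤ r⁻¹ * R := by positivity
  have hexp : r⁻¹ * ((N + 1) * R + 1) = r⁻¹ * (N * R) + r⁻¹ * R + r⁻¹ := by ring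
  have hun : ‖u‖ = 1 := by simpa using hu.1
  have hud : dist u u₀ < η := hu.2
  let A : E →+ E × ℝ × ℂ :=
    (r⁻¹ • ContinuousLinearMap.inl ℝ E (ℝ × ℂ) : E →L[ℝ] E × ℝ × ℂ).toLinearMap.toAddMonoidHom
  have hA : ∀ z, A z = (r⁻¹ • z, 0, 0) := fun z => by
    change r⁻¹ • (z, (0 : ℝ × ℂ)) = _
    rw [Prod.smul_mk, smul_zero]
    rfl
  have hkey := iteratedDiff_eq_mul ((r : ℂ) ^ (-s)) A l hlR (distPow K T₀ s) G (r • u)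
    (u, r⁻¹, s) (by
      intro z hz
      rw [hl] at hz
      have hzr : ‖r⁻¹ • z‖ ≤ r⁻¹ * (N * R) := by
        rw [norm_smul, norm_inv, Real.norm_of_nonneg hr0.le]
        gcongr
      have hmem : (u + r⁻¹ • z, r⁻¹) ∈ Metric.ball (u₀, (0 : ℝ)) ε₂ := by
        rw [Metric.mem_ball, Prod.dist_eq, max_lt_iff]
        constructor
        · have := dist_triangle (u + r⁻¹ • z) u u₀
          simp only [dist_self_add_left] at this
          simp only
          linarith
        · simp only [dist_zero_right, Real.norm_of_nonneg hrinv.le]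
          linarith
      have hWv := hball _ hmem hrinv
      have hru : r • (u + r⁻¹ • z) = r • u + z := by rw [smul_add, smul_inv_smul₀ hr0.ne']
      simp only [inv_inv, hru] at hWv
      have hT₀ : T₀ ≤ Metric.infDist (r • u + z) K := by
        have h1 := norm_le_infDist_add hn hM (r • u + z)
        have h2 := norm_sub_le (r • u + z) z
        rw [add_sub_cancel_right, norm_smul, hun, Real.norm_of_nonneg hr0.le, mul_one] at h2
        linarith
      have hpos : 0 < Metric.infDist (r • u + z) K := hT.trans_le hT₀
      rw [distPow, max_eq_left hT₀, ← exp_neg_mul_log hr0]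
      simp only [hG, hA, Prod.mk_add_mk, add_zero]
      rw [← hWv, Real.log_mul hrinv.ne' hpos.ne', Real.log_inv, ← Complex.exp_add]
      congr 1
      push_cast
      ring)
  rw [hkey, norm_mul, Complex.norm_cpow_eq_rpow_re_of_pos hr0, Complex.neg_re, sub_eq_add_neg,
    Real.rpow_add hr0, ← mul_assoc, mul_comm (C * R ^ N), mul_assoc (r ^ (-s.re))]
  refine mul_le_mul_of_nonneg_left ?_ (by positivity)
  have hsteps : ∀ h ∈ l.map A, ‖h‖ ≤ R * r⁻¹ := by
    intro h hh
    obtain ⟨y, hy, rfl⟩ := List.mem_map.1 hh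
    have hyR := hlR y hy
    rw [hA, Prod.norm_mk, norm_smul, norm_inv, Real.norm_of_nonneg hr0.le]
    simp only [Prod.mk_zero_zero, norm_zero]
    rw [max_eq_left (by positivity), mul_comm]
    gcongr
  refine (hbound (u, r⁻¹, s) ?_ (l.map A) (by simpa using hl) fun h hh =>
    (hsteps h hh).trans_lt ?_).trans ?_
  · rw [Metric.mem_ball, Prod.dist_eq, Prod.dist_eq, max_lt_iff, max_lt_iff]
    refine ⟨hud.trans_le hη1, ?_, (Metric.mem_ball.1 hs).trans_le hη1⟩
    simp only [dist_zero_right, Real.norm_of_nonneg hrinv.le]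
    linarith
  · linarith
  · rw [mul_assoc]
    refine mul_le_mul_of_nonneg_left ((prod_map_norm_le _ hsteps).trans (le_of_eq ?_)) hC
    rw [List.length_map, hl, mul_pow, Real.rpow_neg hr0.le, Real.rpow_natCast, inv_pow]

theorem IsSupportMap.exists_norm_iteratedDiff_distPow_le {K : Set E} {P : E → E}
    (hP : IsSupportMap K P) (hc : IsCompact K) (hn : K.Nonempty) (hcv : Convex ℝ K) {T₀ : ℝ}
    (hT : 0 < T₀) (s₀ : ℂ) (N : ℕ) {R : ℝ} (hR : 0 ≤ R) :
    ∃ η > 0, ∃ r₀ > 0, ∃ C, 0 ≤ C ∧ ∀ s ∈ Metric.ball s₀ η, ∀ v : E, r₀ ≤ ‖v‖ →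
      ∀ l : List E, l.length = N → (∀ y ∈ l, ‖y‖ ≤ R) →
        ‖iteratedDiff l (distPow K T₀ s) v‖ ≤ C * ‖v‖ ^ (-s.re - N) := by
  have key : ∃ η > 0, ∃ r₀ > 0, ∃ C, 0 ≤ C ∧ ∀ u ∈ Metric.sphere (0 : E) 1,
      ∀ s ∈ Metric.ball s₀ η, ∀ r ≥ r₀, ∀ l : List E, l.length = N → (∀ y ∈ l, ‖y‖ ≤ R) →
        ‖iteratedDiff l (distPow K T₀ s) (r • u)‖ ≤ C * r ^ (-s.re - N) := by
    refine (isCompact_sphere (0 : E) 1).induction_on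
      (p := fun S => ∃ η > 0, ∃ r₀ > 0, ∃ C, 0 ≤ C ∧ ∀ u ∈ S,
      ∀ s ∈ Metric.ball s₀ η, ∀ r ≥ r₀, ∀ l : List E, l.length = N → (∀ y ∈ l, ‖y‖ ≤ R) →
        ‖iteratedDiff l (distPow K T₀ s) (r • u)‖ ≤ C * r ^ (-s.re - N)) ?_ ?_ ?_ ?_
    · exact ⟨1, one_pos, 1, one_pos, 0, le_rfl, by simp⟩
    · rintro S S' hSS' ⟨η, hη, r₀, hr₀, C, hC, h⟩
      exact ⟨η, hη, r₀, hr₀, C, hC, fun u hu => h u (hSS' hu)⟩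
    · rintro S S' ⟨η, hη, r₀, hr₀, C, hC, h⟩ ⟨η', hη', r₀', hr₀', C', hC', h'⟩
      refine ⟨min η η', lt_min hη hη', max r₀ r₀', lt_max_of_lt_left hr₀, C + C', by positivity,
        fun u hu s hs r hr l hl hlR => ?_⟩
      have hr1 : r₀ ≤ r := (le_max_left _ _).trans hr
      have hr2 : r₀' ≤ r := (le_max_right _ _).trans hr
      have hrp : 0 ≤ r ^ (-s.re - N) := Real.rpow_nonneg (hr₀.le.trans hr1) _
      have h1 := mul_nonneg hC hrp
      have h2 := mul_nonneg hC' hrp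
      rw [add_mul]
      rcases hu with hu | hu
      · have := h u hu s (Metric.ball_subset_ball (min_le_left _ _) hs) r hr1 l hl hlR
        linarith
      · have := h' u hu s (Metric.ball_subset_ball (min_le_right _ _) hs) r hr2 l hl hlR
        linarith
    · intro u₀ hu₀
      obtain ⟨η, hη, h⟩ := hP.exists_norm_iteratedDiff_distPow_le_near hc hn hcv hT s₀ N hR
        (u₀ := u₀) (by simpa using hu₀)
      exact ⟨_, inter_mem_nhdsWithin _ (Metric.ball_mem_nhds u₀ hη), η, hη, h⟩
  obtain ⟨η, hη, r₀, hr₀, C, hC, h⟩ := key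
  refine ⟨η, hη, r₀, hr₀, C, hC, fun s hs v hv l hl hlR => ?_⟩
  have hv0 : 0 < ‖v‖ := hr₀.trans_le hv
  have := h (‖v‖⁻¹ • v) (by simp [norm_smul, hv0.ne']) s hs ‖v‖ hv l hl hlR
  rwa [smul_inv_smul₀ hv0.ne'] at this

end SymbolEstimate

/-! ## The integral of a power of the distance -/

section Integral

theorem integral_Ioi_mul_cpow {s : ℂ} (hs : 0 < s.re) {m : ℝ} (hm : 0 < m) :
    ∫ t in Set.Ioi m, s * (t : ℂ) ^ (-s - 1) = (m : ℂ) ^ (-s) := by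
  have hs0 : s ≠ 0 := by
    rintro rfl
    simp at hs
  rw [integral_const_mul, integral_Ioi_cpow_of_lt (by simpa [sub_lt_iff_lt_add] using hs) hm, sub_add_cancel]
  field_simp

/-- The layer-cake form of the truncated power: it depends on `δ` only through the indicator of `δ ≤
t`, whose integral over space is a volume. -/
theorem integral_Ioi_indicator_cpow {s : ℂ} (hs : 0 < s.re) {δ T : ℝ} (hT : 0 < T) :
    ∫ t in Set.Ioi T, (Set.Ici δ).indicator (fun t : ℝ => s * (t : ℂ) ^ (-s - 1)) t =
      ((max δ T : ℝ) : ℂ) ^ (-s) := by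
  rw [setIntegral_indicator measurableSet_Ici, ← integral_Ioi_mul_cpow hs (lt_max_of_lt_right hT)]
  rcases le_or_gt δ T with h | h
  · rw [max_eq_right h, Set.inter_eq_left.2 (Set.Ioi_subset_Ici h)]
  · rw [max_eq_left h.le, Set.inter_eq_right.2 (Set.Ici_subset_Ioi.2 h),
      integral_Ici_eq_integral_Ioi]

variable {E : Type*} [NormedAddCommGroup E] [NormedSpace ℝ E] [FiniteDimensional ℝ E]
  [MeasurableSpace E] [BorelSpace E]

/-- Layer-cake and Fubini reduce the integral to that of `s t^(-s-1)` times the volume polynomial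
over `t > T`; each monomial is integrable there since `l ≤ n < Re s`. -/
theorem integral_distPow (μ : Measure E) [μ.IsAddHaarMeasure] {K : Set E} {n : ℕ} {a : ℕ → ℝ}
    (hfin : ∀ t, μ {v | Metric.infDist v K ≤ t} ≠ ⊤)
    (ha : ∀ t, 0 < t → μ.real {v | Metric.infDist v K ≤ t} = ∑ l ∈ Finset.range (n + 1), a l * t ^ l)
    {T : ℝ} (hT : 0 < T) {s : ℂ} (hs : n < s.re) :
    ∫ v, distPow K T s v ∂μ =
      ∑ l ∈ Finset.range (n + 1), (a l : ℂ) * (s * (T : ℂ) ^ ((l : ℂ) - s) / (s - l)) := by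
  have hn0 : (0 : ℝ) ≤ n := by positivity
  have hs0 : 0 < s.re := by linarith
  have hms : ∀ t, MeasurableSet {v : E | Metric.infDist v K ≤ t} := fun t =>
    (isClosed_le (Metric.continuous_infDist_pt K) continuous_const).measurableSet
  set F : E → ℝ → ℂ := fun v t =>
    (Set.Ici (Metric.infDist v K)).indicator (fun t : ℝ => s * (t : ℂ) ^ (-s - 1)) t with hF
  have hFv : ∀ t, (fun v => F v t) =
      {v | Metric.infDist v K ≤ t}.indicator fun _ => s * (t : ℂ) ^ (-s - 1) := by
    intro t
    funext v
    simp [hF, Set.indicator_apply]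
  have hmeas : AEStronglyMeasurable (Function.uncurry F) (μ.prod (volume.restrict (Set.Ioi T))) := by
    have h1 : Function.uncurry F = {q : E × ℝ | Metric.infDist q.1 K ≤ q.2}.indicator
        fun q => s * (q.2 : ℂ) ^ (-s - 1) := by
      funext q
      simp [hF, Set.indicator_apply, Function.uncurry]
    rw [h1]
    refine (Measurable.indicator ?_ ?_).aestronglyMeasurable
    · exact ((Complex.measurable_ofReal.comp measurable_snd).pow_const _).const_mul s
    · exact (isClosed_le ((Metric.continuous_infDist_pt K).comp continuous_fst)
        continuous_snd).measurableSet
  have hint : Integrable (Function.uncurry F) (μ.prod (volume.restrict (Set.Ioi T))) := by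
    rw [integrable_prod_iff' hmeas]
    constructor
    · refine Eventually.of_forall fun t => ?_
      simp only [Function.uncurry_apply_pair]
      rw [hFv, integrable_indicator_iff (hms t)]
      exact integrableOn_const (hfin t)
    · simp only [Function.uncurry_apply_pair]
      have h1 : ∀ t ∈ Set.Ioi T, ∫ v, ‖F v t‖ ∂μ =
          ∑ l ∈ Finset.range (n + 1), a l * ‖s‖ * t ^ ((l : ℝ) - s.re - 1) := by
        intro t ht
        have ht0 : 0 < t := hT.trans ht
        have h2 : (fun v => ‖F v t‖) = {v | Metric.infDist v K ≤ t}.indicator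
            fun _ => ‖s * (t : ℂ) ^ (-s - 1)‖ := by
          funext v
          rw [congrFun (hFv t) v, norm_indicator_eq_indicator_norm]
        rw [h2, integral_indicator (hms t), setIntegral_const, ha t ht0, smul_eq_mul,
          Finset.sum_mul, norm_mul, Complex.norm_cpow_eq_rpow_re_of_pos ht0]
        refine Finset.sum_congr rfl fun l _ => ?_
        have h3 : (l : ℝ) - s.re - 1 = l + (-s - 1).re := by simp; ring
        rw [h3, Real.rpow_add ht0, Real.rpow_natCast]
        ring
      refine (integrableOn_congr_fun h1 measurableSet_Ioi).2 ?_
      refine integrable_finsetSum _ fun l hl => ?_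
      have hl' : (l : ℝ) ≤ n := by exact_mod_cast Nat.lt_succ_iff.1 (Finset.mem_range.1 hl)
      exact (integrableOn_Ioi_rpow_of_lt (by linarith) hT).const_mul _
  have h1 : ∀ v, distPow K T s v = ∫ t in Set.Ioi T, F v t := fun v => by
    rw [distPow_eq K hT, hF, integral_Ioi_indicator_cpow hs0 hT]
  simp only [h1]
  rw [integral_integral_swap hint]
  have h2 : ∀ t ∈ Set.Ioi T, ∫ v, F v t ∂μ =
      ∑ l ∈ Finset.range (n + 1), (a l : ℂ) * s * (t : ℂ) ^ ((l : ℂ) - s - 1) := by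
    intro t ht
    have ht0 : 0 < t := hT.trans ht
    rw [hFv, integral_indicator (hms t), setIntegral_const, ha t ht0, Complex.real_smul]
    push_cast
    rw [Finset.sum_mul]
    refine Finset.sum_congr rfl fun l _ => ?_
    have h3 : (l : ℂ) - s - 1 = l + (-s - 1) := by ring
    rw [h3, Complex.cpow_add _ _ (by exact_mod_cast ht0.ne'), Complex.cpow_natCast]
    ring
  rw [setIntegral_congr_fun measurableSet_Ioi h2]
  have h3 : ∀ l ∈ Finset.range (n + 1), ((l : ℂ) - s - 1).re < -1 := by
    intro l hl
    have hl' : (l : ℝ) ≤ n := by exact_mod_cast Nat.lt_succ_iff.1 (Finset.mem_range.1 hl)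
    simp
    linarith
  rw [integral_finsetSum _ fun l hl =>
    (integrableOn_Ioi_cpow_of_lt (h3 l hl) hT).const_mul ((a l : ℂ) * s)]
  refine Finset.sum_congr rfl fun l hl => ?_
  rw [integral_const_mul, integral_Ioi_cpow_of_lt (h3 l hl) hT, sub_add_cancel]
  have h4 : s - l ≠ 0 := by
    intro h0
    have h5 := h3 l hl
    rw [show (l : ℂ) - s = -(s - l) by ring, h0] at h5
    simp at h5
  rw [← neg_sub s, div_neg, neg_div, neg_neg]
  ring

end Integral

/-! ## Analytic continuation -/

section Continuation

theorem isPreconnected_re_gt (c : ℝ) : IsPreconnected {s : ℂ | c < s.re} :=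
  (convex_halfSpace_re_gt c).isPreconnected

theorem isOpen_re_gt (c : ℝ) : IsOpen {s : ℂ | c < s.re} :=
  isOpen_lt continuous_const Complex.continuous_re

/-- Holomorphic functions on growing half-planes that agree on the first one glue to an entire
function. -/
theorem exists_entire_of_halfPlanes {c : ℝ} {Z : ℂ → ℂ} {G : ℕ → ℂ → ℂ}
    (hG : ∀ N : ℕ, DifferentiableOn ℂ (G N) {s | c - N < s.re})
    (hZ : ∀ N s, c < s.re → G N s = Z s) :
    ∃ F : ℂ → ℂ, Differentiable ℂ F ∧ ∀ s : ℂ, c < s.re → F s = Z s := by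
  have key : ∀ M N : ℕ, M ≤ N → Set.EqOn (G M) (G N) {s | c - M < s.re} := by
    intro M N hMN
    have hMN' : (M : ℝ) ≤ N := by exact_mod_cast hMN
    have hM0 : (0 : ℝ) ≤ M := by positivity
    have hmem : ((c + 1 : ℝ) : ℂ) ∈ {s : ℂ | c < s.re} := by simp
    have hsub : {s : ℂ | c - M < s.re} ⊆ {s | c - N < s.re} := fun s hs => by
      have h : c - M < s.re := hs
      show c - N < s.re
      linarith
    refine AnalyticOnNhd.eqOn_of_preconnected_of_eventuallyEq
      ((hG M).analyticOnNhd (isOpen_re_gt _)) (((hG N).mono hsub).analyticOnNhd (isOpen_re_gt _)) (isPreconnected_re_gt _) (z₀ := ((c + 1 : ℝ) : ℂ))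
      (by simp only [Set.mem_ofPred_eq, Complex.ofReal_re]; linarith) ?_
    filter_upwards [(isOpen_re_gt c).mem_nhds hmem] with s hs
    rw [hZ M s hs, hZ N s hs]
  -- An index whose half-plane contains `s`. The glued function uses this index pointwise, and near
  -- each point it agrees with one fixed `G N`.
  have hN : ∀ s : ℂ, c - (⌈c - s.re⌉₊ + 1 : ℕ) < s.re := by
    intro s
    have := Nat.le_ceil (c - s.re)
    push_cast
    linarith
  have hF : ∀ (N : ℕ) (s : ℂ), c - N < s.re → G (⌈c - s.re⌉₊ + 1) s = G N s := by
    intro N s hs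
    rcases le_total N (⌈c - s.re⌉₊ + 1) with h | h
    · exact (key _ _ h hs).symm
    · exact key _ _ h (hN s)
  refine ⟨fun s => G (⌈c - s.re⌉₊ + 1) s, fun s₀ => ?_, fun s hs => hZ _ s hs⟩
  have hnhds := (isOpen_re_gt _).mem_nhds (hN s₀)
  refine ((hG _).differentiableAt hnhds).congr_of_eventuallyEq ?_
  filter_upwards [hnhds] with s hs
  exact hF _ s hs

/-- Each term is entire in `s`, and `N` defects improve the decay to `‖v‖^(-Re s - N)`, so the
series converges normally near every point of the half-plane. -/
theorem IsSupportMap.differentiableOn_tsum_iterate {E : Type} [NormedAddCommGroup E]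
    [InnerProductSpace ℝ E] [FiniteDimensional ℝ E] [MeasurableSpace E] [BorelSpace E] {K : Set E}
    {P : E → E} (hP : IsSupportMap K P) (hc : IsCompact K) (hn : K.Nonempty) (hcv : Convex ℝ K)
    {T₀ : ℝ} (hT : 0 < T₀) {ι : Type*} [Fintype ι] (b : Module.Basis ι ℝ E) (μ : Measure E)
    [μ.IsAddHaarMeasure] (N : ℕ) :
    DifferentiableOn ℂ (fun s => ∑' v : Submodule.span ℤ (Set.range b),
        (translationDefect (cellMeasure b μ))^[N] (distPow K T₀ s) v)
      {s | (Module.finrank ℝ E : ℝ) - N < s.re} := by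
  obtain ⟨R, hR, hν⟩ := exists_ae_cellMeasure_norm_le b μ
  intro s₀ hs₀
  obtain ⟨η, hη, r₀, hr₀, C, hC, hbound⟩ :=
    hP.exists_norm_iteratedDiff_distPow_le hc hn hcv hT s₀ N hR
  -- Half of the margin in the exponent: near `s₀` the decay exponent still exceeds the dimension by
  -- `κ`.
  set κ := (s₀.re + N - Module.finrank ℝ E) / 2 with hκ
  have hκpos : 0 < κ := by
    have : (Module.finrank ℝ E : ℝ) - N < s₀.re := hs₀
    rw [hκ]; linarith
  set ε := min (min η κ) 1 with hε
  have hεpos : 0 < ε := by positivity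
  have hcont := continuous_iterate_translationDefect hν (continuous_distPow K hT) N
  have hM : ∀ v : E, ∃ M, ∀ s ∈ Metric.closedBall s₀ ε,
      ‖(translationDefect (cellMeasure b μ))^[N] (distPow K T₀ s) v‖ ≤ M := fun v =>
    (isCompact_closedBall s₀ ε).exists_bound_of_continuousOn
      (hcont.comp (f := fun s => (s, v)) (by fun_prop)).continuousOn
  choose M hM using hM
  set σ := (Module.finrank ℝ E : ℝ) + κ with hσ
  have hdiff : DifferentiableOn ℂ (fun s => ∑' v : Submodule.span ℤ (Set.range b),
      (translationDefect (cellMeasure b μ))^[N] (distPow K T₀ s) v) (Metric.ball s₀ ε) := by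
    -- The symbol estimate dominates the distant lattice points; the finitely many others are
    -- bounded by compactness of a disc around `s₀`.
    refine Complex.differentiableOn_tsum_of_summable_norm
      (u := fun v => if max r₀ 1 ≤ ‖v‖ then C * ‖v‖ ^ (-σ) else M v) ?_ ?_ Metric.isOpen_ball ?_
    · refine summable_of_decay _ (σ := σ) (C := C) (by linarith) ?_
      rw [eventually_cofinite]
      have hfin := ZSpan.setFinite_inter b
        (Metric.isBounded_closedBall (x := (0 : E)) (r := max r₀ 1))
      refine (hfin.preimage Subtype.val_injective.injOn).subset fun v hv => ?_
      have hlt : ‖v‖ < max r₀ 1 := by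
        by_contra! h
        refine hv ?_
        rw [if_pos h, Real.norm_of_nonneg (by positivity)]
      exact ⟨by simpa using hlt.le, v.2⟩
    · exact fun v s _ => (hasDerivAt_iterate_translationDefect hν (continuous_distPow K hT)
        (continuous_distPowDeriv K hT) (hasDerivAt_distPow K T₀) N
        s v).differentiableAt.differentiableWithinAt
    · intro v s hs
      split_ifs with h
      · have hsη : s ∈ Metric.ball s₀ η :=
          Metric.ball_subset_ball ((min_le_left _ _).trans (min_le_left _ _)) hs
        refine (norm_iterate_translationDefect_le hν (continuous_distPow_right K hT s)
          fun l hl hlR => hbound s hsη v ((le_max_left _ _).trans h) l hl hlR).trans ?_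
        refine mul_le_mul_of_nonneg_left ?_ hC
        refine Real.rpow_le_rpow_of_exponent_le ((le_max_right _ _).trans h) ?_
        have h1 : |(s - s₀).re| < κ := (Complex.abs_re_le_norm _).trans_lt (by
          rw [← dist_eq_norm]
          exact (Metric.mem_ball.1 hs).trans_le ((min_le_left _ _).trans (min_le_right _ _)))
        rw [Complex.sub_re] at h1
        have h2 := (abs_lt.1 h1).1
        rw [hσ]
        linarith
      · exact hM v s (Metric.ball_subset_closedBall hs)
  exact (hdiff.differentiableAt (Metric.ball_mem_nhds s₀ hεpos)).differentiableWithinAt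

end Continuation

/-! ## The lattice of the torus -/

section TorusLattice

/-- The basis `2π e_i` of `2πℤ^d`. -/
def torusBasis (d : ℕ) : Module.Basis (Fin d) ℝ (EuclideanSpace ℝ (Fin d)) :=
  (EuclideanSpace.basisFun (Fin d) ℝ).toBasis.unitsSMul
    fun _ => Units.mk0 (2 * Real.pi) Real.two_pi_pos.ne'

theorem mem_span_torusBasis_iff {d : ℕ} (v : EuclideanSpace ℝ (Fin d)) :
    v ∈ Submodule.span ℤ (Set.range (torusBasis d)) ↔ v ∈ torusLattice d := by
  rw [Module.Basis.mem_span_iff_repr_mem]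
  refine forall_congr' fun i => ?_
  have h : (torusBasis d).repr v i = (2 * Real.pi)⁻¹ * v i := by
    rw [torusBasis, Module.Basis.repr_unitsSMul]
    simp [Units.smul_def]
  rw [h, Set.mem_range]
  refine exists_congr fun n => ?_
  rw [algebraMap_int_eq, Int.coe_castRingHom, eq_inv_mul_iff_mul_eq₀ Real.two_pi_pos.ne']
  exact eq_comm

theorem volume_real_fundamentalDomain_torusBasis (d : ℕ) :
    volume.real (ZSpan.fundamentalDomain (torusBasis d)) = (2 * Real.pi) ^ d := by
  rw [ZSpan.measureReal_fundamentalDomain (torusBasis d) volume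
    (EuclideanSpace.basisFun (Fin d) ℝ).toBasis, torusBasis, Module.Basis.det_unitsSMul_self]
  have h : volume.real (ZSpan.fundamentalDomain (EuclideanSpace.basisFun (Fin d) ℝ).toBasis) = 1 := by
    rw [Measure.real, measure_congr (ZSpan.fundamentalDomain_ae_parallelepiped _ volume),
      OrthonormalBasis.coe_toBasis, OrthonormalBasis.volume_parallelepiped]
    simp
  rw [h, mul_one]
  simp [abs_of_pos Real.pi_pos]

end TorusLattice

/-! ## Orthogeodesics and lattice points -/

section Orthogeodesics

variable {d : ℕ} {K₁ K₂ : Set (EuclideanSpace ℝ (Fin d))}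
  {P₁ P₂ : EuclideanSpace ℝ (Fin d) → EuclideanSpace ℝ (Fin d)}

theorem IsSupportMap.mem_outwardNormalBundle_iff {K : Set (EuclideanSpace ℝ (Fin d))}
    {P : EuclideanSpace ℝ (Fin d) → EuclideanSpace ℝ (Fin d)} (hP : IsSupportMap K P)
    {x θ : EuclideanSpace ℝ (Fin d)} (hθ : ‖θ‖ = 1) : (x, θ) ∈ outwardNormalBundle K ↔ x = P θ := by
  have h0 : θ ≠ 0 := norm_ne_zero_iff.1 (by rw [hθ]; exact one_ne_zero)
  constructor
  · rintro ⟨h1, -, h2⟩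
    exact hP.eq h0 x h1 h2
  · rintro rfl
    exact ⟨hP.mem h0, hθ, hP.inner_le h0⟩

theorem torusProj_eq_iff {x y : EuclideanSpace ℝ (Fin d)} :
    torusProj x = torusProj y ↔ y - x ∈ torusLattice d := by
  rw [torusProj, torusProj, QuotientAddGroup.eq, neg_add_eq_sub]

/-- The velocity determines both endpoints up to the lattice, so the arrival condition says that a
single vector is a lattice point. -/
theorem mem_orthogeodesics_iff (h₁ : IsSupportMap K₁ P₁) (h₂ : IsSupportMap K₂ P₂)
    (γ : GeodesicArc d) : γ ∈ orthogeodesics K₁ K₂ ↔ torusProj (P₁ γ.velocity) = γ.start ∧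
      γ.length • γ.velocity + (P₁ γ.velocity - P₂ (-γ.velocity)) ∈ torusLattice d := by
  have hn : ‖-γ.velocity‖ = 1 := by rw [norm_neg, γ.norm_velocity]
  have h0 : γ.point 0 = γ.start := by
    rw [GeodesicArc.point, zero_smul]
    exact add_zero _
  simp only [orthogeodesics, inwardNormalBundle, Set.mem_ofPred_eq,
    h₁.mem_outwardNormalBundle_iff γ.norm_velocity, h₂.mem_outwardNormalBundle_iff hn,
    exists_eq_left, h0]
  refine and_congr_right fun h => ?_
  have h3 : γ.point γ.length = torusProj (P₁ γ.velocity + γ.length • γ.velocity) := by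
    rw [GeodesicArc.point, ← h]
    rfl
  rw [h3, torusProj_eq_iff]
  congr! 1
  abel

/-- By monotonicity of `P`, `w - w'` has nonpositive inner product with itself. -/
theorem IsSupportMap.add_injective {E : Type*} [NormedAddCommGroup E] [InnerProductSpace ℝ E]
    {K : Set E} {P : E → E} (hP : IsSupportMap K P) {w w' : E} (hw : w ≠ 0) (hw' : w' ≠ 0)
    (h : w + P w = w' + P w') : w = w' := by
  have h1 := hP.inner_sub_nonneg hw hw'
  have h2 : P w - P w' = -(w - w') := by
    rw [neg_sub, sub_eq_sub_iff_add_eq_add, add_comm, h, add_comm]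
  rw [h2, inner_neg_left, Left.nonneg_neg_iff] at h1
  exact sub_eq_zero.1 (real_inner_self_nonpos.1 h1)

theorem IsSmoothStrictlyConvex.isCompact_sub (hK₁ : IsSmoothStrictlyConvex K₁)
    (hK₂ : IsSmoothStrictlyConvex K₂) : IsCompact (K₁ - K₂) := by
  rw [sub_eq_add_neg]
  exact hK₁.isCompact.add hK₂.isCompact.neg

/-- Orthogeodesics correspond to the lattice points outside of `K₁ - K₂`, their length being the
distance of the lattice point to `K₁ - K₂`. -/
theorem exists_equiv_orthogeodesics (hK₁ : IsSmoothStrictlyConvex K₁)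
    (hK₂ : IsSmoothStrictlyConvex K₂) :
    ∃ e : orthogeodesics K₁ K₂ ≃ {v : EuclideanSpace ℝ (Fin d) // v ∈ torusLattice d ∧
      v ∉ K₁ - K₂}, ∀ γ, Metric.infDist (e γ : EuclideanSpace ℝ (Fin d)) (K₁ - K₂) = γ.1.length := by
  obtain ⟨P₁, h₁⟩ := hK₁.exists_isSupportMap
  obtain ⟨P₂, h₂⟩ := hK₂.exists_isSupportMap
  have hP := h₁.sub h₂
  have hn : (K₁ - K₂).Nonempty := hK₁.nonempty.sub hK₂.nonempty
  have hc : IsCompact (K₁ - K₂) := hK₁.isCompact_sub hK₂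
  have hcv : Convex ℝ (K₁ - K₂) := hK₁.convex.sub hK₂.convex
  set P := fun θ => P₁ θ - P₂ (-θ) with hPdef
  have hv0 : ∀ γ : GeodesicArc d, γ.velocity ≠ 0 := fun γ =>
    norm_ne_zero_iff.1 (by rw [γ.norm_velocity]; exact one_ne_zero)
  have hw0 : ∀ γ : GeodesicArc d, γ.length • γ.velocity ≠ 0 := fun γ =>
    smul_ne_zero γ.length_pos.ne' (hv0 γ)
  have hPw : ∀ γ : GeodesicArc d, P (γ.length • γ.velocity) = P γ.velocity := fun γ =>
    hP.smul (hv0 γ) γ.length_pos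
  have hnorm : ∀ γ : GeodesicArc d, ‖γ.length • γ.velocity‖ = γ.length := fun γ => by
    rw [norm_smul, γ.norm_velocity, mul_one, Real.norm_of_nonneg γ.length_pos.le]
  have hdist : ∀ γ : GeodesicArc d,
      Metric.infDist (γ.length • γ.velocity + P γ.velocity) (K₁ - K₂) = γ.length := fun γ => by
    rw [← hPw, hP.infDist (hw0 γ), hnorm]
  let f : orthogeodesics K₁ K₂ → {v : EuclideanSpace ℝ (Fin d) // v ∈ torusLattice d ∧
      v ∉ K₁ - K₂} := fun γ => ⟨γ.1.length • γ.1.velocity + P γ.1.velocity,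
        ((mem_orthogeodesics_iff h₁ h₂ γ.1).1 γ.2).2, fun hmem => by
          have h := hdist γ.1
          rw [Metric.infDist_zero_of_mem hmem] at h
          exact γ.1.length_pos.ne h⟩
  refine ⟨Equiv.ofBijective f ⟨?_, ?_⟩, fun γ => hdist γ.1⟩
  · rintro ⟨γ, hγ⟩ ⟨γ', hγ'⟩ h
    have h3 : γ.length • γ.velocity + P γ.velocity = γ'.length • γ'.velocity + P γ'.velocity :=
      congrArg Subtype.val h
    rw [← hPw γ, ← hPw γ'] at h3
    have h4 := hP.add_injective (hw0 γ) (hw0 γ') h3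
    have h5 : γ.length = γ'.length := by rw [← hnorm γ, h4, hnorm γ']
    have h6 : γ.velocity = γ'.velocity := by
      rw [h5] at h4
      exact smul_right_injective _ γ'.length_pos.ne' h4
    have h7 : γ.start = γ'.start := by
      rw [← ((mem_orthogeodesics_iff h₁ h₂ γ).1 hγ).1, ← ((mem_orthogeodesics_iff h₁ h₂ γ').1 hγ').1,
        h6]
    exact Subtype.ext (GeodesicArc.ext h5 h7 h6)
  · rintro ⟨v, hvL, hvK⟩
    obtain ⟨w, hw, rfl⟩ := hP.exists_add_eq hc hn hcv hvK
    have hwn : 0 < ‖w‖ := norm_pos_iff.2 hw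
    let γ : GeodesicArc d :=
      { length := ‖w‖
        start := torusProj (P₁ (‖w‖⁻¹ • w))
        velocity := ‖w‖⁻¹ • w
        length_pos := hwn
        norm_velocity := by rw [norm_smul, norm_inv, norm_norm, inv_mul_cancel₀ hwn.ne'] }
    have hγ : γ.length • γ.velocity + P γ.velocity = w + P w := by
      rw [← hPw γ]
      change ‖w‖ • ‖w‖⁻¹ • w + P (‖w‖ • ‖w‖⁻¹ • w) = _
      rw [smul_inv_smul₀ hwn.ne']
    refine ⟨⟨γ, (mem_orthogeodesics_iff h₁ h₂ γ).2 ⟨rfl, ?_⟩⟩, Subtype.ext hγ⟩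
    change γ.length • γ.velocity + P γ.velocity ∈ _
    rwa [hγ]

end Orthogeodesics

/-! ## The zeta function -/

section Zeta

variable {d : ℕ}

/-- The lattice `2πℤ^d` as a `ℤ`-submodule. -/
abbrev torusSubmodule (d : ℕ) : Submodule ℤ (EuclideanSpace ℝ (Fin d)) :=
  Submodule.span ℤ (Set.range (torusBasis d))

theorem finite_setOf_infDist_le {K : Set (EuclideanSpace ℝ (Fin d))} (hn : K.Nonempty)
    (hb : Bornology.IsBounded K) (T : ℝ) :
    {v : torusSubmodule d | Metric.infDist (v : EuclideanSpace ℝ (Fin d)) K ≤ T}.Finite := by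
  obtain ⟨M, hM⟩ := hb.exists_norm_le
  have hfin := ZSpan.setFinite_inter (torusBasis d)
    (Metric.isBounded_closedBall (x := (0 : EuclideanSpace ℝ (Fin d))) (r := T + M))
  refine (hfin.preimage Subtype.val_injective.injOn).subset fun v hv => ⟨?_, v.2⟩
  have hv' : Metric.infDist (v : EuclideanSpace ℝ (Fin d)) K ≤ T := hv
  rw [mem_closedBall_zero_iff]
  linarith [norm_le_infDist_add hn hM (v : EuclideanSpace ℝ (Fin d))]

theorem exists_equiv_longOrthogeodesics {K₁ K₂ : Set (EuclideanSpace ℝ (Fin d))}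
    (hK₁ : IsSmoothStrictlyConvex K₁) (hK₂ : IsSmoothStrictlyConvex K₂) {T₀ : ℝ} (hT : 0 < T₀) :
    ∃ e : longOrthogeodesics K₁ K₂ T₀ ≃ ({v | Metric.infDist (v : EuclideanSpace ℝ (Fin d))
      (K₁ - K₂) ≤ T₀}ᶜ : Set (torusSubmodule d)),
      ∀ γ, Metric.infDist ((e γ : torusSubmodule d) : EuclideanSpace ℝ (Fin d)) (K₁ - K₂) =
        γ.1.length := by
  obtain ⟨e, he⟩ := exists_equiv_orthogeodesics hK₁ hK₂
  let f : longOrthogeodesics K₁ K₂ T₀ → ({v | Metric.infDist (v : EuclideanSpace ℝ (Fin d))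
      (K₁ - K₂) ≤ T₀}ᶜ : Set (torusSubmodule d)) := fun γ =>
    ⟨⟨e ⟨γ.1, γ.2.1⟩, (mem_span_torusBasis_iff _).2 (e ⟨γ.1, γ.2.1⟩).2.1⟩, fun h => by
      have h1 : Metric.infDist (e ⟨γ.1, γ.2.1⟩ : EuclideanSpace ℝ (Fin d)) (K₁ - K₂) ≤ T₀ := h
      rw [he] at h1
      exact absurd γ.2.2 (not_lt.2 h1)⟩
  refine ⟨Equiv.ofBijective f ⟨?_, ?_⟩, fun γ => he _⟩
  · intro γ γ' h
    have h1 : (e ⟨γ.1, γ.2.1⟩ : EuclideanSpace ℝ (Fin d)) = e ⟨γ'.1, γ'.2.1⟩ :=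
      congrArg (fun v => ((v.1 : torusSubmodule d) : EuclideanSpace ℝ (Fin d))) h
    have h2 := congrArg Subtype.val (e.injective (Subtype.ext h1))
    exact Subtype.ext h2
  · rintro ⟨⟨v, hvL⟩, hv⟩
    have hv' : T₀ < Metric.infDist v (K₁ - K₂) := not_le.1 hv
    have hvK : v ∉ K₁ - K₂ := fun hmem => by
      rw [Metric.infDist_zero_of_mem hmem] at hv'
      exact lt_asymm hT hv'
    obtain ⟨γ, hγ⟩ := e.surjective ⟨v, (mem_span_torusBasis_iff v).1 hvL, hvK⟩
    have hlen : T₀ < γ.1.length := by rwa [← he γ, hγ]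
    have hv2 : (e γ : EuclideanSpace ℝ (Fin d)) = v := congrArg Subtype.val hγ
    exact ⟨⟨γ.1, γ.2, hlen⟩, Subtype.ext (Subtype.ext hv2)⟩

theorem one_div_length_cpow {K : Set (EuclideanSpace ℝ (Fin d))} {T₀ : ℝ} (hT : 0 < T₀)
    {v : EuclideanSpace ℝ (Fin d)} (hv : T₀ < Metric.infDist v K) (s : ℂ) :
    1 / (Metric.infDist v K : ℂ) ^ s = distPow K T₀ s v := by
  rw [distPow_eq K hT, max_eq_left hv.le, Complex.cpow_neg, one_div]

theorem summable_distPow {K : Set (EuclideanSpace ℝ (Fin d))} (hn : K.Nonempty)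
    (hb : Bornology.IsBounded K) {T₀ : ℝ} (hT : 0 < T₀) {s : ℂ} (hs : (d : ℝ) < s.re) :
    Summable fun v : torusSubmodule d => distPow K T₀ s v :=
  summable_of_decay_one_add _ (by simpa using hs)
    (exists_distPow_decay hn hb hT (d.cast_nonneg.trans hs.le))

theorem summable_longOrthogeodesics {K₁ K₂ : Set (EuclideanSpace ℝ (Fin d))}
    (hK₁ : IsSmoothStrictlyConvex K₁) (hK₂ : IsSmoothStrictlyConvex K₂) {T₀ : ℝ} (hT : 0 < T₀)
    {s : ℂ} (hs : (d : ℝ) < s.re) :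
    Summable fun γ : longOrthogeodesics K₁ K₂ T₀ => 1 / (γ.1.length : ℂ) ^ s := by
  obtain ⟨e, he⟩ := exists_equiv_longOrthogeodesics hK₁ hK₂ hT
  have h := summable_distPow (hK₁.nonempty.sub hK₂.nonempty) (hK₁.isCompact_sub hK₂).isBounded hT hs
  refine (e.summable_iff.2 (h.subtype _)).congr fun γ => ?_
  rw [← he γ, one_div_length_cpow hT (not_le.1 (e γ).2)]
  rfl

/-- The lattice points within `T₀` of `K₁ - K₂` belong to no orthogeodesic in the sum, and the
truncation gives each of them the value `T₀^(-s)`. -/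
theorem epsteinZeta_eq {K₁ K₂ : Set (EuclideanSpace ℝ (Fin d))}
    (hK₁ : IsSmoothStrictlyConvex K₁) (hK₂ : IsSmoothStrictlyConvex K₂) {T₀ : ℝ} (hT : 0 < T₀)
    {s : ℂ} (hs : (d : ℝ) < s.re) :
    epsteinZeta K₁ K₂ T₀ s = ∑' v : torusSubmodule d, distPow (K₁ - K₂) T₀ s v -
      (Nat.card {v : torusSubmodule d | Metric.infDist (v : EuclideanSpace ℝ (Fin d))
        (K₁ - K₂) ≤ T₀} : ℂ) * (T₀ : ℂ) ^ (-s) := by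
  obtain ⟨e, he⟩ := exists_equiv_longOrthogeodesics hK₁ hK₂ hT
  have h := summable_distPow (hK₁.nonempty.sub hK₂.nonempty) (hK₁.isCompact_sub hK₂).isBounded hT hs
  rw [← h.tsum_subtype_add_tsum_subtype_compl {v : torusSubmodule d |
    Metric.infDist (v : EuclideanSpace ℝ (Fin d)) (K₁ - K₂) ≤ T₀}, ← e.tsum_eq, epsteinZeta]
  have h1 : ∀ v : {v : torusSubmodule d | Metric.infDist (v : EuclideanSpace ℝ (Fin d))
        (K₁ - K₂) ≤ T₀}, distPow (K₁ - K₂) T₀ s (v : torusSubmodule d) = (T₀ : ℂ) ^ (-s) := by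
    rintro ⟨v, hv⟩
    rw [distPow_eq _ hT, max_eq_right hv]
  simp only [h1, tsum_const, nsmul_eq_mul, add_sub_cancel_left]
  refine tsum_congr fun γ => ?_
  rw [← he γ, one_div_length_cpow hT (not_le.1 (e γ).2)]

theorem finite_orthogeodesics {K₁ K₂ : Set (EuclideanSpace ℝ (Fin d))}
    (hK₁ : IsSmoothStrictlyConvex K₁) (hK₂ : IsSmoothStrictlyConvex K₂) {T₀ : ℝ} (hT : 0 < T₀)
    (T : ℝ) : {γ ∈ orthogeodesics K₁ K₂ | T₀ < γ.length ∧ γ.length ≤ T}.Finite := by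
  obtain ⟨e, he⟩ := exists_equiv_longOrthogeodesics hK₁ hK₂ hT
  have hfin := finite_setOf_infDist_le (hK₁.nonempty.sub hK₂.nonempty)
    (hK₁.isCompact_sub hK₂).isBounded T
  have h1 : Set.InjOn (fun γ => ((e γ : torusSubmodule d)))
      ((fun γ => (e γ : torusSubmodule d)) ⁻¹' {v : torusSubmodule d |
        Metric.infDist (v : EuclideanSpace ℝ (Fin d)) (K₁ - K₂) ≤ T}) :=
    (Subtype.val_injective.comp e.injective).injOn
  refine ((hfin.preimage h1).image Subtype.val).subset ?_
  rintro γ ⟨hγ, hγ₀, hγT⟩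
  refine ⟨⟨γ, hγ, hγ₀⟩, ?_, rfl⟩
  show Metric.infDist _ _ ≤ T
  rw [he]
  exact hγT

/-- `s * T ^ (l - s) / (s - l)` is the sum of its polar part `l / (s - l)` and an entire function. -/
theorem exists_entire_cpow_div {T : ℝ} (hT : 0 < T) (l : ℕ) :
    ∃ D : ℂ → ℂ, Differentiable ℂ D ∧ ∀ s : ℂ, s ≠ l →
      s * (T : ℂ) ^ ((l : ℂ) - s) / (s - l) = l / (s - l) + D s := by
  have hT0 : (T : ℂ) ≠ 0 := by exact_mod_cast hT.ne'
  have hg : Differentiable ℂ fun s : ℂ => s * (T : ℂ) ^ ((l : ℂ) - s) := fun s =>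
    differentiableAt_id.mul ((differentiableAt_id.const_sub (l : ℂ)).const_cpow (Or.inl hT0))
  refine ⟨dslope (fun s : ℂ => s * (T : ℂ) ^ ((l : ℂ) - s)) l, ?_, fun s hs => ?_⟩
  · rw [← differentiableOn_univ] at hg ⊢
    exact (Complex.differentiableOn_dslope univ_mem).2 hg
  · have := sub_ne_zero.2 hs
    rw [dslope_of_ne _ hs, slope_def_field, sub_self, Complex.cpow_zero]
    field_simp
    ring

theorem add_smul_closedBall_eq_setOf_infDist_le {K : Set (EuclideanSpace ℝ (Fin d))} (hc : IsCompact K)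
    (hn : K.Nonempty) {t : ℝ} (ht : 0 < t) :
    K + t • Metric.closedBall (0 : EuclideanSpace ℝ (Fin d)) 1 = {v | Metric.infDist v K ≤ t} := by
  ext v
  exact mem_add_smul_closedBall_iff hc hn ht

end Zeta

end

theorem theorem1p3 (d : ℕ) (hd : 2 ≤ d) (K₁ K₂ : Set (EuclideanSpace ℝ (Fin d)))
    (hK₁ : IsSmoothStrictlyConvex K₁) (hK₂ : IsSmoothStrictlyConvex K₂) :
    -- the intrinsic volumes of the Minkowski difference are well defined by Steiner's formula
    SteinerFormula (K₁ - K₂) (intrinsicVolume (K₁ - K₂)) ∧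
    ∀ T₀ : ℝ, 0 < T₀ →
      -- the zeta function is well defined on the half-plane `Re s > d`
      (∀ T : ℝ, {γ ∈ orthogeodesics K₁ K₂ | T₀ < γ.length ∧ γ.length ≤ T}.Finite) ∧
      (∀ s : ℂ, (d : ℝ) < s.re →
        Summable fun γ : longOrthogeodesics K₁ K₂ T₀ => 1 / (γ.1.length : ℂ) ^ s) ∧
      -- and it is, up to an entire function, the announced sum of simple poles
      ∃ F : ℂ → ℂ, Differentiable ℂ F ∧
        ∀ s : ℂ, (d : ℝ) < s.re →
          F s = epsteinZeta K₁ K₂ T₀ s -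
            1 / (2 * (Real.pi : ℂ)) ^ d *
              ∑ l ∈ Finset.Icc 1 d,
                ((Real.pi ^ ((l : ℝ) / 2) * (l : ℝ) / Real.Gamma ((l : ℝ) / 2 + 1) : ℝ) : ℂ) *
                  ((intrinsicVolume (K₁ - K₂) (d - l) : ℝ) : ℂ) / (s - (l : ℂ)) := by
  obtain ⟨P₁, h₁⟩ := hK₁.exists_isSupportMap
  obtain ⟨P₂, h₂⟩ := hK₂.exists_isSupportMap
  have hP := h₁.sub h₂
  have hn : (K₁ - K₂).Nonempty := hK₁.nonempty.sub hK₂.nonempty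
  have hc : IsCompact (K₁ - K₂) := hK₁.isCompact_sub hK₂
  have hcv : Convex ℝ (K₁ - K₂) := hK₁.convex.sub hK₂.convex
  have hSteiner : SteinerFormula (K₁ - K₂) (intrinsicVolume (K₁ - K₂)) := by
    obtain ⟨Q, hQ, hQe⟩ := hP.exists_polynomial_volume volume hc hn hcv
    exact steinerFormula_intrinsicVolume
      (steinerFormula_of_polynomial (by simpa using hQ) hQe)
  refine ⟨hSteiner, fun T₀ hT => ⟨finite_orthogeodesics hK₁ hK₂ hT,
    fun s hs => summable_longOrthogeodesics hK₁ hK₂ hT hs, ?_⟩⟩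
  set a : ℕ → ℝ := fun l => intrinsicVolume (K₁ - K₂) (d - l) *
    (Real.pi ^ ((l : ℝ) / 2) / Real.Gamma ((l : ℝ) / 2 + 1)) with ha
  have hint : ∀ s : ℂ, (d : ℝ) < s.re → ∫ v, distPow (K₁ - K₂) T₀ s v =
      ∑ l ∈ Finset.range (d + 1), (a l : ℂ) * (s * (T₀ : ℂ) ^ ((l : ℂ) - s) / (s - l)) := by
    intro s hs
    refine integral_distPow volume (fun t => ?_) (fun t ht => ?_) hT hs
    · obtain ⟨M, hM⟩ := hc.isBounded.exists_norm_le
      have hb : Bornology.IsBounded {v | Metric.infDist v (K₁ - K₂) ≤ t} :=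
        Metric.isBounded_closedBall.subset fun v (hv : _ ≤ _) =>
          mem_closedBall_zero_iff.2 ((norm_le_infDist_add hn hM v).trans (add_le_add_left hv M))
      exact hb.measure_lt_top.ne
    · rw [← add_smul_closedBall_eq_setOf_infDist_le hc hn ht]
      exact hSteiner t ht
  -- The exponent `N + 1` ensures at least one defect, which is what removes the integral from the
  -- lattice sum.
  obtain ⟨F, hF, hFe⟩ := exists_entire_of_halfPlanes (c := d)
    (Z := fun s => ∑' v : torusSubmodule d, distPow (K₁ - K₂) T₀ s v -
      ((((2 * Real.pi) ^ d)⁻¹ : ℝ) : ℂ) * ∫ v, distPow (K₁ - K₂) T₀ s v)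
    (G := fun N s => ∑' v : torusSubmodule d,
      (translationDefect (cellMeasure (torusBasis d) volume))^[N + 1] (distPow (K₁ - K₂) T₀ s) v)
    (fun N => by
      refine (hP.differentiableOn_tsum_iterate hc hn hcv hT (torusBasis d) volume (N + 1)).mono
        fun s hs => ?_
      have hs' : (d : ℝ) - N < s.re := hs
      show (Module.finrank ℝ (EuclideanSpace ℝ (Fin d)) : ℝ) - (N + 1 : ℕ) < s.re
      rw [finrank_euclideanSpace_fin]
      push_cast
      linarith)
    (fun N s hs => by
      have h := tsum_eq_integral_add_tsum_iterate (torusBasis d) volume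
        (continuous_distPow_right (K₁ - K₂) hT s) (σ := s.re) (by simpa using hs)
        (exists_distPow_decay hn hc.isBounded hT (d.cast_nonneg.trans hs.le)) N
      rw [volume_real_fundamentalDomain_torusBasis, Complex.real_smul] at h
      rw [h, add_sub_cancel_left])
  choose D hD hDe using fun l : ℕ => exists_entire_cpow_div hT l
  refine ⟨fun s => F s + ((((2 * Real.pi) ^ d)⁻¹ : ℝ) : ℂ) *
    ∑ l ∈ Finset.range (d + 1), (a l : ℂ) * D l s -
      (Nat.card {v : torusSubmodule d | Metric.infDist (v : EuclideanSpace ℝ (Fin d))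
        (K₁ - K₂) ≤ T₀} : ℂ) * (T₀ : ℂ) ^ (-s), ?_, fun s hs => ?_⟩
  · refine (hF.add ((Differentiable.fun_sum fun l _ => (hD l).const_mul _).const_mul _)).sub
      (Differentiable.const_mul (fun s => ?_) _)
    exact differentiableAt_id.neg.const_cpow (Or.inl (by exact_mod_cast hT.ne'))
  · have hpolar : ∑ l ∈ Finset.range (d + 1), (a l : ℂ) * (s * (T₀ : ℂ) ^ ((l : ℂ) - s) / (s - l)) =
        ∑ l ∈ Finset.range (d + 1), (a l : ℂ) * D l s +
        ∑ l ∈ Finset.Icc 1 d,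
                ((Real.pi ^ ((l : ℝ) / 2) * (l : ℝ) / Real.Gamma ((l : ℝ) / 2 + 1) : ℝ) : ℂ) *
                  ((intrinsicVolume (K₁ - K₂) (d - l) : ℝ) : ℂ) / (s - (l : ℂ)) := by
      have h1 : ∑ l ∈ Finset.Icc 1 d,
                ((Real.pi ^ ((l : ℝ) / 2) * (l : ℝ) / Real.Gamma ((l : ℝ) / 2 + 1) : ℝ) : ℂ) *
                  ((intrinsicVolume (K₁ - K₂) (d - l) : ℝ) : ℂ) / (s - (l : ℂ)) =
          ∑ l ∈ Finset.range (d + 1), (a l : ℂ) * (l / (s - l)) := by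
        -- The constant term of the Steiner polynomial produces no pole: its coefficient is
        -- multiplied by `l = 0`.
        rw [Finset.range_eq_Ico, Finset.sum_eq_sum_Ico_succ_bot (Nat.succ_pos d)]
        simp only [Nat.cast_zero, zero_div, mul_zero, zero_add]
        refine Finset.sum_congr (by ext; simp) fun l _ => ?_
        simp only [ha]
        push_cast
        ring
      rw [h1, ← Finset.sum_add_distrib]
      refine Finset.sum_congr rfl fun l hl => ?_
      have hl' : (l : ℝ) ≤ d := by exact_mod_cast Nat.lt_succ_iff.1 (Finset.mem_range.1 hl)
      have hne : s ≠ l := by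
        rintro rfl
        simp only [Complex.natCast_re] at hs
        linarith
      rw [hDe l s hne]
      ring
    beta_reduce
    rw [hFe s hs, epsteinZeta_eq hK₁ hK₂ hT hs, hint s hs, hpolar]
    push_cast
    rw [one_div]
    ring
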